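/- All functions live on $(0,\infty)$ and take values in $[0,\infty]$, with $0\cdot\infty=0/0=0$, $1/\infty=0$. For measurable $A\subseteq(0,\infty)$ put $\|f\|_{p,A}=\big(\int_A f^p\big)^{1/p}$ if $0<p<\infty$ and $\|f\|_{\infty,A}=\operatorname{ess\,sup}_A f$; a weight is a measurable function that is positive and finite a.e. For $0<p,q<\infty$, measurable $u\ge 0$ and a weight $v$, put $$\|f\|_{\mathrm{Ces}_{p,q}(u,v)}=\Big\|\,u(t)\,\|fv\|_{p,(0,t)}\Big\|_{q,(0,\infty)},\qquad \|f\|_{\mathrm{Cop}_{p,q}(u,v)}=\Big\|\,u(t)\,\|fv\|_{p,(t,\infty)}\Big\|_{q,(0,\infty)}$$ (the outer norm is taken in $t$), and let $\mathrm{Ces}_{p,q}(u,v)$, $\mathrm{Cop}_{p,q}(u,v)$ be the sets of measurable $f\ge0$ for which these are finite. The norm $\|\mathrm{Id}\|_{X\to Y}\in[0,\infty]$ of an embedding is the least $c$ with $\|f\|_Y\le c\|f\|_X$ for all $f\in X$ ($\infty$ if there is no finite such $c$). For $q<p$ let $p\to q$ be defined by $\frac1{p\to q}=\frac1q-\frac1p$.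 A function $U$ on $[0,\infty)$ is admissible if it is finite, continuous and strictly increasing with $U(0)=0$ and $\lim_{t\to\infty}U(t)=\infty$; $Q_U$ is the set of functions $\varphi$ on $(0,\infty)$ such that $\varphi$ is equivalent (up to a multiplicative constant) to a nondecreasing function, $\varphi/U$ is equivalent to a nonincreasing function, and $$\lim_{t\to0+}\varphi(t)=\lim_{t\to\infty}\frac1{\varphi(t)}=\lim_{t\to\infty}\frac{\varphi(t)}{U(t)}=\lim_{t\to0+}\frac{U(t)}{\varphi(t)}=0.$$ **Theorem.** Let $0<p_1,p_2,q_1,q_2<\infty$, $p_2<p_1$, $q_1\le p_2<q_2$. Let $v_1,v_2$ be weights, and let $u_1,u_2\ge0$ be measurable with $0<\|u_1\|_{q_1,(0,t)}<\infty$ and $0<\|u_2\|_{q_2,(t,\infty)}<\infty$ for all $t>0$. Put $$V(x)=\|v_1^{-1}v_2\|_{p_1\to p_2,(0,x)},\qquad \mathcal V(t,x)=\frac{V(t)}{V(t)+V(x)},\qquad \varphi_1(x)=\operatorname*{ess\,sup}_{t\in(0,\infty)}V(t)\,\mathcal V(x,t)\,\|u_1\|_{q_1,(0,t)}^{-1}.$$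 Assume that $V$ is admissible and that $\varphi_1\in Q_{V^{1/(p_1\to p_2)}}$. Then, with constants of equivalence that depend only on $p_1,p_2,q_1,q_2$: (i) if $p_1\le q_2$, then $$\|\mathrm{Id}\|_{\mathrm{Cop}_{p_1,q_1}(u_1,v_1)\to \mathrm{Ces}_{p_2,q_2}(u_2,v_2)}\approx\sup_{x>0}\varphi_1(x)\sup_{t>0}\mathcal V(t,x)\,\|u_2\|_{q_2,(t,\infty)};$$ (ii) if $q_2<p_1$, then $$\|\mathrm{Id}\|_{\mathrm{Cop}_{p_1,q_1}(u_1,v_1)\to \mathrm{Ces}_{p_2,q_2}(u_2,v_2)}\approx\sup_{x>0}\varphi_1(x)\Big(\int_0^\infty\mathcal V(t,x)^{p_1\to q_2}\,d\big(-\|u_2\|_{q_2,(t,\infty)}^{p_1\to q_2}\big)\Big)^{\frac1{p_1\to q_2}},$$ where the integral is a Lebesgue–Stieltjes integral over $(0,\infty)$. -/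

import Mathlib

open Set Filter Topology MeasureTheory
open scoped ENNReal NNReal

noncomputable section

namespace CesaroCopson

/-! All functions are functions on the half-line `(0,∞)` with values in `[0,∞]`; they are modelled
by functions `ℝ → ℝ≥0∞` whose values off `(0,∞)` are never used. The arithmetic of `ℝ≥0∞` has
`0 * ∞ = 0`, `0 / 0 = 0` and `1 / ∞ = 0`. -/

/-- The functional `‖f‖_{p,A}`: `(∫_A f^p)^{1/p}` for `0 < p < ∞` and `ess sup_A f` for `p = ∞`. -/
def normOn (p : ℝ≥0∞) (f : ℝ → ℝ≥0∞) (A : Set ℝ) : ℝ≥0∞ :=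
  eLpNorm f p (volume.restrict A)

/-- Nonnegative (Lebesgue) measurable functions on `(0,∞)`. -/
def MeasPos : Set (ℝ → ℝ≥0∞) :=
  {f | AEMeasurable f (volume.restrict (Ioi 0))}

/-- Weights on `(0,∞)`: measurable functions, positive and finite almost everywhere. -/
def Weights : Set (ℝ → ℝ≥0∞) :=
  {w | w ∈ MeasPos ∧ ∀ᵐ x ∂(volume.restrict (Ioi (0 : ℝ))), 0 < w x ∧ w x < ∞}

/-- The class of all nonnegative measurable `u` with `0 < ‖u‖_{q,(t,∞)} < ∞` for all `t > 0`. -/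
def Omega (q : ℝ≥0∞) : Set (ℝ → ℝ≥0∞) :=
  {u | u ∈ MeasPos ∧ ∀ t : ℝ, 0 < t → 0 < normOn q u (Ioi t) ∧ normOn q u (Ioi t) < ∞}

/-- The class of all nonnegative measurable `u` with `0 < ‖u‖_{q,(0,t)} < ∞` for all `t > 0`. -/
def DualOmega (q : ℝ≥0∞) : Set (ℝ → ℝ≥0∞) :=
  {u | u ∈ MeasPos ∧ ∀ t : ℝ, 0 < t → 0 < normOn q u (Ioo 0 t) ∧ normOn q u (Ioo 0 t) < ∞}

/-- The Cesàro functional `‖ ‖f‖_{p,v,(0,·)} ‖_{q,u,(0,∞)}`, where `‖f‖_{p,v,A} = ‖f v‖_{p,A}`. -/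
def cesNorm (p q : ℝ≥0∞) (u v f : ℝ → ℝ≥0∞) : ℝ≥0∞ :=
  normOn q (fun t => normOn p (fun x => f x * v x) (Ioo 0 t) * u t) (Ioi 0)

/-- The Copson functional `‖ ‖f‖_{p,v,(·,∞)} ‖_{q,u,(0,∞)}`, where `‖f‖_{p,v,A} = ‖f v‖_{p,A}`. -/
def copNorm (p q : ℝ≥0∞) (u v f : ℝ → ℝ≥0∞) : ℝ≥0∞ :=
  normOn q (fun t => normOn p (fun x => f x * v x) (Ioi t) * u t) (Ioi 0)

/-- The weighted Copson space `Cop_{p,q}(u,v)`. -/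
def Cop (p q : ℝ≥0∞) (u v : ℝ → ℝ≥0∞) : Set (ℝ → ℝ≥0∞) :=
  {f | f ∈ MeasPos ∧ copNorm p q u v f < ∞}

/-- The norm of the embedding `Cop_{p₁,q₁}(u₁,v₁) ↪ Ces_{p₂,q₂}(u₂,v₂)`: the best constant `c` in
`‖f‖_Ces ≤ c ‖f‖_Cop` for all `f ∈ Cop_{p₁,q₁}(u₁,v₁)`. It is `∞` if there is no finite such
constant, that is, if the embedding fails. -/
def embNorm (p₁ q₁ : ℝ≥0∞) (u₁ v₁ : ℝ → ℝ≥0∞) (p₂ q₂ : ℝ≥0∞) (u₂ v₂ : ℝ → ℝ≥0∞) : ℝ≥0∞ :=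
  sInf {c : ℝ≥0∞ | ∀ f ∈ Cop p₁ q₁ u₁ v₁, cesNorm p₂ q₂ u₂ v₂ f ≤ c * copNorm p₁ q₁ u₁ v₁ f}

/-- The exponent `p → q`: `1/(p → q) = 1/q - 1/p` if `q < p`, and `p → q = ∞` if `p ≤ q`. -/
def arrow (p q : ℝ≥0∞) : ℝ≥0∞ :=
  if q < p then (q⁻¹ - p⁻¹)⁻¹ else ∞

/-- `V(x) = ‖v₁⁻¹ v₂‖_{p₁ → p₂,(0,x)}`. -/
def V (p₁ p₂ : ℝ≥0∞) (v₁ v₂ : ℝ → ℝ≥0∞) (x : ℝ) : ℝ≥0∞ :=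
  normOn (arrow p₁ p₂) (fun s => (v₁ s)⁻¹ * v₂ s) (Ioo 0 x)

/-- The kernel `U(t) / (U(t) + U(x))`. -/
def kernel (U : ℝ → ℝ≥0∞) (t x : ℝ) : ℝ≥0∞ :=
  U t / (U t + U x)

/-- Two quantities in `[0,∞]` are equivalent with the (finite) constant `C`. -/
def EquivWith (C : ℝ≥0) (a b : ℝ≥0∞) : Prop :=
  a ≤ C * b ∧ b ≤ C * a

/-- Equivalence, up to a constant, of two functions on `(0,∞)`. -/
def EquivOn (f g : ℝ → ℝ≥0∞) : Prop :=
  ∃ C : ℝ≥0, ∀ x : ℝ, 0 < x → EquivWith C (f x) (g x)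

/-- Admissible functions: finite, continuous and strictly increasing on `[0,∞)`, with `U(0) = 0`
and `U(t) → ∞` as `t → ∞`. -/
structure Admissible (U : ℝ → ℝ≥0∞) : Prop where
  finite : ∀ x : ℝ, 0 ≤ x → U x < ∞
  continuousOn : ContinuousOn U (Ici 0)
  strictMonoOn : StrictMonoOn U (Ici 0)
  zero : U 0 = 0
  tendsto : Tendsto U atTop (𝓝 ∞)

/-- The family `Q_U` of non-degenerate `U`-quasiconcave functions. -/
structure NondegQuasiconcave (U φ : ℝ → ℝ≥0∞) : Prop where
  increasing : ∃ g : ℝ → ℝ≥0∞, MonotoneOn g (Ioi 0) ∧ EquivOn φ g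
  decreasing : ∃ g : ℝ → ℝ≥0∞, AntitoneOn g (Ioi 0) ∧ EquivOn (fun t => φ t / U t) g
  tendsto_zero : Tendsto φ (𝓝[>] 0) (𝓝 0)
  tendsto_inv : Tendsto (fun t => 1 / φ t) atTop (𝓝 0)
  tendsto_div : Tendsto (fun t => φ t / U t) atTop (𝓝 0)
  tendsto_div_zero : Tendsto (fun t => U t / φ t) (𝓝[>] 0) (𝓝 0)

/-- `φ₁(x) = ess sup_{t ∈ (0,∞)} V(t) 𝒱(x,t) ‖u₁‖_{q₁,(0,t)}⁻¹`. -/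
def phi₁ (p₁ p₂ q₁ : ℝ≥0∞) (u₁ v₁ v₂ : ℝ → ℝ≥0∞) (x : ℝ) : ℝ≥0∞ :=
  essSup (fun t => V p₁ p₂ v₁ v₂ t * kernel (V p₁ p₂ v₁ v₂) x t * (normOn q₁ u₁ (Ioo 0 t))⁻¹)
    (volume.restrict (Ioi 0))

instance instCompactIccSpaceIoi : CompactIccSpace (Ioi (0 : ℝ)) where
  isCompact_Icc {a b} := by
    rw [Subtype.isCompact_iff]
    have h : ((↑) : Ioi (0 : ℝ) → ℝ) '' Icc a b = Icc (a : ℝ) b := by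
      ext x
      constructor
      · rintro ⟨y, hy, rfl⟩
        exact hy
      · intro hx
        exact ⟨⟨x, lt_of_lt_of_le a.2 hx.1⟩, hx, rfl⟩
    rw [h]
    exact isCompact_Icc

theorem monotone_subtype {F : ℝ → ℝ} (hF : MonotoneOn F (Ioi 0)) :
    Monotone (fun t : Ioi (0 : ℝ) => F t) :=
  fun a b hab => hF a.2 b.2 hab

/-- The Lebesgue–Stieltjes measure `dF` on `(0,∞)` of a nondecreasing function `F : (0,∞) → ℝ`,
regarded as a measure on `ℝ` carried by `(0,∞)`. -/
def stieltjesMeasure (F : ℝ → ℝ) (hF : MonotoneOn F (Ioi 0)) : Measure ℝ :=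
  (monotone_subtype hF).stieltjesFunction.measure.map Subtype.val

theorem monotoneOn_neg_tail {q : ℝ≥0∞} {u : ℝ → ℝ≥0∞} (hu : u ∈ Omega q) {s : ℝ} (hs : 0 ≤ s) :
    MonotoneOn (fun t => -(normOn q u (Ioi t) ^ s).toReal) (Ioi 0) := by
  intro a ha b _ hab
  refine neg_le_neg (ENNReal.toReal_mono ?_ ?_)
  · exact (ENNReal.rpow_lt_top_of_nonneg hs (hu.2 a ha).2.ne).ne
  · exact ENNReal.rpow_le_rpow
      (eLpNorm_mono_measure u (Measure.restrict_mono (Ioi_subset_Ioi hab) le_rfl)) hs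

/-- The measure `d(-‖u‖_{q,(t,∞)}^s)` on `(0,∞)`, for `u` with finite tail norms and `s ≥ 0`. -/
def tailMeasure {q : ℝ≥0∞} {u : ℝ → ℝ≥0∞} (hu : u ∈ Omega q) (s : ℝ≥0∞) : Measure ℝ :=
  stieltjesMeasure (fun t => -(normOn q u (Ioi t) ^ s.toReal).toReal)
    (monotoneOn_neg_tail hu ENNReal.toReal_nonneg)

end CesaroCopson

end

open CesaroCopson

/-!
Why the theorem holds. Put `ω = v₂ / v₁` and `φ = f v₁`, so that `V(t) = ‖ω‖_{r,(0,t)}` with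
`r = p₁ → p₂`, and write `U₁(t) = ‖u₁‖_{q₁,(0,t)}`, `U₂(t) = ‖u₂‖_{q₂,(t,∞)}`. Since `V` is
continuous and runs through `(0,∞)`, there is a mesh `x k`, `k ∈ ℤ`, with `V(x k) = 2 ^ k`
(`DyadicMesh`). The norm of the embedding is equivalent to the best constant `A` in the discrete
inequality
`‖2 ^ k U₂(x k) y k‖_{ℓ^{q₂}(k ≤ K)} ≤ A U₁(x K) ‖y‖_{ℓ^{p₁}}` for all `K` and all `y ≥ 0`.

* The discrete inequality implies the embedding (`DyadicMesh.cesaro_le_copson`). The function is cut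
  along the sets on which `U₁` is of order `2 ^ n`. On one piece, Hölder's inequality on the blocks
  of the mesh and Young's inequality for a geometric convolution give a Hardy inequality
  (`DyadicMesh.hardy`). The pieces are put together by Minkowski's inequality in `L^{q₂/p₂}`, which
  uses `p₂ < q₂`, and by `ℓ^{q₁} ⊆ ℓ^{p₂}`, which uses `q₁ ≤ p₂` (`tsum_levelSet_le`).
* The embedding implies the discrete inequality (`DyadicMesh.discrete_of_cesaro_le_copson`), by
  testing it on multiples of `ω ^ (r / p₁)`, the extremal of Hölder's inequality, on each block.

The best constant of a diagonal operator `ℓ^{p₁} → ℓ^{q₂}` is the supremum of its entries if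
`p₁ ≤ q₂` and their `ℓ^ρ` norm, `ρ = p₁ → q₂`, if `q₂ < p₁`. The right-hand sides of the theorem are
the same quantities in disguise: on the one hand
`V(s) 𝒱(x,s) 𝒱(t,x) ≤ min (V(s)) (V(t))`, with equality up to a constant at `x = s`, and on the
other hand `min (V(t)) (2 ^ K) ^ ρ` is equivalent to the sum of `2 ^ (k ρ)` over the `k ≤ K` with
`x k < t`, which integrates against `d(-U₂ ^ ρ)` to the sum of `(2 ^ k U₂(x k)) ^ ρ` over `k ≤ K`.
-/

namespace CesaroCopson

/-! ### Inequalities for sums in `[0,∞]` -/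

theorem tsum_rpow_le_rpow_tsum {ι : Type*} (c : ι → ℝ≥0∞) {s : ℝ} (hs : 1 ≤ s) :
    ∑' i, c i ^ s ≤ (∑' i, c i) ^ s := by
  have hsplit : ∀ a : ℝ≥0∞, a ^ s = a * a ^ (s - 1) := fun a => by
    conv_lhs => rw [show s = 1 + (s - 1) by ring]
    rw [ENNReal.rpow_add_of_nonneg _ _ zero_le_one (by linarith), ENNReal.rpow_one]
  rw [hsplit (∑' i, c i), ← ENNReal.tsum_mul_right]
  refine ENNReal.tsum_le_tsum fun i => ?_
  rw [hsplit]
  gcongr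
  exact ENNReal.le_tsum i

/-- The inclusion `ℓ^a ⊆ ℓ^b` for `a ≤ b`, with norm at most one; also for exponents below one. -/
theorem tsum_rpow_rpow_le {ι : Type*} (c : ι → ℝ≥0∞) {a b : ℝ} (ha : 0 < a) (hab : a ≤ b) :
    (∑' i, c i ^ b) ^ (1 / b) ≤ (∑' i, c i ^ a) ^ (1 / a) := by
  have hb : 0 < b := ha.trans_le hab
  have h := tsum_rpow_le_rpow_tsum (fun i => c i ^ a) (s := b / a) ((one_le_div ha).2 hab)
  simp only [← ENNReal.rpow_mul, mul_div_cancel₀ b ha.ne'] at h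
  calc (∑' i, c i ^ b) ^ (1 / b) ≤ ((∑' i, c i ^ a) ^ (b / a)) ^ (1 / b) := by gcongr
    _ = _ := by
      rw [← ENNReal.rpow_mul]
      congr 1
      field_simp

theorem lintegral_rpow_sum_le {α ι : Type*} [MeasurableSpace α] {μ : Measure α}
    {φ : ι → α → ℝ≥0∞} (hφ : ∀ i, AEMeasurable (φ i) μ) {s : ℝ} (hs : 1 ≤ s) (F : Finset ι) :
    (∫⁻ x, (∑ i ∈ F, φ i x) ^ s ∂μ) ^ (1 / s) ≤ ∑ i ∈ F, (∫⁻ x, φ i x ^ s ∂μ) ^ (1 / s) := by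
  classical
  have hs0 : 0 < s := by linarith
  induction F using Finset.induction_on with
  | empty => simp [hs0]
  | insert i F hi ih =>
    simp only [Finset.sum_insert hi]
    refine (ENNReal.lintegral_Lp_add_le (hφ i)
      (Finset.aemeasurable_fun_sum F fun j _ => hφ j) hs).trans ?_
    gcongr

/-- Minkowski's inequality for a countable sum. -/
theorem lintegral_rpow_tsum_le {α ι : Type*} [Countable ι] [MeasurableSpace α] {μ : Measure α}
    {φ : ι → α → ℝ≥0∞} (hφ : ∀ i, AEMeasurable (φ i) μ) {s : ℝ} (hs : 1 ≤ s) :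
    (∫⁻ x, (∑' i, φ i x) ^ s ∂μ) ^ (1 / s) ≤ ∑' i, (∫⁻ x, φ i x ^ s ∂μ) ^ (1 / s) := by
  have hs0 : 0 < s := by linarith
  have key : ∀ x, (∑' i, φ i x) ^ s = ⨆ F : Finset ι, (∑ i ∈ F, φ i x) ^ s := fun x => by
    rw [ENNReal.tsum_eq_iSup_sum]
    exact (ENNReal.orderIsoRpow s hs0).map_iSup _
  simp only [key]
  rw [lintegral_iSup_directed]
  · rw [one_div, ENNReal.rpow_inv_le_iff hs0]
    refine iSup_le fun F => ?_
    rw [← ENNReal.rpow_inv_le_iff hs0, ← one_div]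
    exact (lintegral_rpow_sum_le hφ hs F).trans (ENNReal.sum_le_tsum F)
  · exact fun F => (Finset.aemeasurable_fun_sum F fun j _ => hφ j).pow_const s
  · refine Monotone.directed_le fun F G hFG x => ?_
    dsimp only
    gcongr

/-- Young's inequality for the convolution with the geometric sequence `q ^ i`, `i ≥ 0`. -/
theorem tsum_rpow_geometric_le (c : ℤ → ℝ≥0∞) (q : ℝ≥0∞) {s : ℝ} (hs : 1 ≤ s) :
    (∑' k : ℤ, (∑' i : ℕ, q ^ i * c (k - i)) ^ s) ^ (1 / s) ≤
      (∑' i : ℕ, q ^ i) * (∑' k : ℤ, c k ^ s) ^ (1 / s) := by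
  have hs0 : 0 < s := by linarith
  have h := lintegral_rpow_tsum_le (μ := (Measure.count : Measure ℤ))
    (φ := fun (i : ℕ) (k : ℤ) => q ^ i * c (k - i))
    (fun i => (measurable_of_countable _).aemeasurable) hs
  simp only [lintegral_count] at h
  refine h.trans ?_
  rw [← ENNReal.tsum_mul_right]
  refine ENNReal.tsum_le_tsum fun i => ?_
  simp only [ENNReal.mul_rpow_of_nonneg _ _ hs0.le]
  rw [ENNReal.tsum_mul_left, ENNReal.mul_rpow_of_nonneg _ _ (by positivity), ← ENNReal.rpow_mul,
    mul_one_div_cancel hs0.ne', ENNReal.rpow_one]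
  rw [← (Equiv.subRight (i : ℤ)).tsum_eq (fun k => c k ^ s)]
  rfl

theorem tsum_Iic_eq_tsum_nat (b : ℤ → ℝ≥0∞) (K : ℤ) :
    ∑' k : Iic K, b k = ∑' i : ℕ, b (K - i) := by
  let e : ℕ ≃ Iic K :=
    { toFun := fun i => ⟨K - i, by simp⟩
      invFun := fun k => (K - k).toNat
      left_inv := fun i => by simp
      right_inv := fun k => by
        have := k.2
        ext
        simp only [mem_Iic] at this
        simp only
        omega }
  rw [← e.tsum_eq]
  rfl

/-- A sum over `S ⊆ ℤ` is the supremum of the sums over `k ≤ K` in `S`, `K ∈ S`; a largest index of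
`S` need not exist. -/
theorem tsum_subtype_le_of_forall_tsum_Iic_le (S : Set ℤ) (b : ℤ → ℝ≥0∞) {X : ℝ≥0∞}
    (h : ∀ K ∈ S, ∑' k : Iic K, b k ≤ X) : ∑' k : S, b k ≤ X := by
  rw [ENNReal.tsum_eq_iSup_sum]
  refine iSup_le fun F => ?_
  rcases F.eq_empty_or_nonempty with rfl | hF
  · simp
  refine le_trans ?_ (h (F.max' hF) (F.max' hF).2)
  let g : F → Iic ((F.max' hF : S) : ℤ) := fun j => ⟨(j : S), F.le_max' _ j.2⟩
  rw [← Finset.sum_coe_sort, ← tsum_fintype (L := .unconditional _)]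
  refine ENNReal.tsum_comp_le_tsum_of_injective (f := g) ?_ (fun k => b k)
  intro x y hxy
  exact Subtype.ext (Subtype.ext (congrArg (fun z : Iic _ => (z : ℤ)) hxy))

/-- The sum of `b` over `S` is at most the supremum over `k ∈ S` of the sums up to `k`; the right-hand
side adds up powers of all of these, which covers an `S` that is unbounded above. -/
theorem rpow_tsum_le_tsum_rpow_partial (S : Set ℤ) (b : ℤ → ℝ≥0∞) {β : ℝ} (hβ : 0 < β) :
    (∑' j : S, b j) ^ β ≤ ∑' k : S, (∑' i : ℕ, b (k - i)) ^ β := by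
  rw [← ENNReal.le_rpow_inv_iff hβ]
  refine tsum_subtype_le_of_forall_tsum_Iic_le S b fun K hK => ?_
  rw [ENNReal.le_rpow_inv_iff hβ, tsum_Iic_eq_tsum_nat]
  exact ENNReal.le_tsum (f := fun k : S => (∑' i : ℕ, b (k - i)) ^ β) ⟨K, hK⟩

theorem two_zpow_rpow (k : ℤ) (s : ℝ) : ((2 : ℝ≥0∞) ^ k) ^ s = (2 : ℝ≥0∞) ^ (k * s) := by
  rw [← ENNReal.rpow_intCast, ← ENNReal.rpow_mul]

theorem two_zpow_pos (k : ℤ) : 0 < (2 : ℝ≥0∞) ^ k :=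
  ENNReal.zpow_pos (by norm_num) (by norm_num) k

theorem two_zpow_ne_top (k : ℤ) : (2 : ℝ≥0∞) ^ k ≠ ∞ :=
  (ENNReal.zpow_lt_top (by norm_num) (by norm_num) k).ne

theorem two_zpow_add_one (k : ℤ) : (2 : ℝ≥0∞) ^ (k + 1) = 2 * 2 ^ k := by
  rw [ENNReal.zpow_add (by norm_num) (by norm_num), zpow_one, mul_comm]

theorem two_zpow_sub_nat_rpow (k : ℤ) (i : ℕ) (s : ℝ) :
    ((2 : ℝ≥0∞) ^ (k - i)) ^ s = ((2 : ℝ≥0∞) ^ k) ^ s * ((2 : ℝ≥0∞) ^ (-s)) ^ i := by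
  rw [two_zpow_rpow, two_zpow_rpow, ← ENNReal.rpow_natCast, ← ENNReal.rpow_mul,
    ← ENNReal.rpow_add _ _ (by norm_num) (by norm_num)]
  congr 1
  push_cast
  ring

/-- The constant `1 + 2 ^ (-s) + 2 ^ (-2 s) + ⋯`. -/
noncomputable def geomConst (s : ℝ) : ℝ≥0∞ := ∑' i : ℕ, ((2 : ℝ≥0∞) ^ (-s)) ^ i

theorem geomConst_ne_top {s : ℝ} (hs : 0 < s) : geomConst s ≠ ∞ := by
  rw [geomConst, ENNReal.tsum_geometric, ENNReal.inv_ne_top]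
  refine (tsub_pos_of_lt ?_).ne'
  exact ENNReal.rpow_lt_one_of_one_lt_of_neg (by norm_num) (by linarith)

theorem one_le_geomConst (s : ℝ) : 1 ≤ geomConst s := by
  have h := ENNReal.le_tsum (f := fun i : ℕ => ((2 : ℝ≥0∞) ^ (-s)) ^ i) 0
  rwa [pow_zero] at h

theorem tsum_Iic_two_zpow_rpow (K : ℤ) (s : ℝ) :
    ∑' k : Iic K, ((2 : ℝ≥0∞) ^ (k : ℤ)) ^ s = geomConst s * ((2 : ℝ≥0∞) ^ K) ^ s := by
  rw [tsum_Iic_eq_tsum_nat (fun k => ((2 : ℝ≥0∞) ^ k) ^ s)]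
  simp only [two_zpow_sub_nat_rpow]
  rw [ENNReal.tsum_mul_left, geomConst, mul_comm]

/-- Solves `B = a + 2 ^ (-s) B` for `B`; used with `B` a multiple of `2 ^ (k s)` and `a`
its increment from `k - 1` to `k`. -/
theorem eq_geomConst_mul_of_eq_add {s : ℝ} (hs : 0 < s) {a B : ℝ≥0∞} (hB : B ≠ ∞)
    (h : B = a + 2 ^ (-s) * B) : B = geomConst s * a := by
  have h1 : (2 : ℝ≥0∞) ^ (-s) < 1 := ENNReal.rpow_lt_one_of_one_lt_of_neg (by norm_num) (by linarith)
  have h2 : (2 : ℝ≥0∞) ^ (-s) * B ≠ ∞ := ENNReal.mul_ne_top h1.ne_top hB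
  have ha : a = (1 - 2 ^ (-s)) * B := by
    rw [ENNReal.sub_mul (fun _ _ => hB), one_mul]
    exact (ENNReal.sub_eq_of_eq_add h2 h).symm
  rw [ha, ← mul_assoc, geomConst, ENNReal.tsum_geometric, ENNReal.inv_mul_cancel, one_mul]
  · exact (tsub_pos_of_lt h1).ne'
  · exact ENNReal.sub_ne_top ENNReal.one_ne_top

/-- Hölder's inequality for sums in the form
`‖τ y‖_{ℓ^q} ≤ ‖τ‖_{ℓ^ρ} ‖y‖_{ℓ^p}`, `1/q = 1/p + 1/ρ`. -/
theorem tsum_mul_rpow_le {ι : Type*} [Countable ι] {q p ρ : ℝ} (hq : 0 < q) (hqp : q < p)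
    (hρ : 1 / q = 1 / p + 1 / ρ) (y τ : ι → ℝ≥0∞) :
    (∑' k, (τ k * y k) ^ q) ^ (1 / q) ≤
      (∑' k, τ k ^ ρ) ^ (1 / ρ) * (∑' k, y k ^ p) ^ (1 / p) := by
  let _ : MeasurableSpace ι := ⊤
  have h := ENNReal.lintegral_Lp_mul_le_Lq_mul_Lr hq hqp hρ Measure.count
    (f := y) (g := τ) (measurable_of_countable _).aemeasurable
    (measurable_of_countable _).aemeasurable
  simp only [lintegral_count, Pi.mul_apply] at h
  simpa only [mul_comm] using h

/-! ### The dyadic mesh and a Hardy inequality -/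

/-- `‖f‖_{p,A}` for a real exponent `p > 0`, written as a Lebesgue integral. -/
noncomputable def lpOn (p : ℝ) (f : ℝ → ℝ≥0∞) (A : Set ℝ) : ℝ≥0∞ :=
  (∫⁻ x in A, f x ^ p) ^ (1 / p)

theorem lpOn_rpow {p : ℝ} (hp : 0 < p) (f : ℝ → ℝ≥0∞) (A : Set ℝ) :
    lpOn p f A ^ p = ∫⁻ x in A, f x ^ p := by
  rw [lpOn, ← ENNReal.rpow_mul, one_div_mul_cancel hp.ne', ENNReal.rpow_one]

theorem normOn_eq_lpOn {p : ℝ≥0∞} (hp : 0 < p ∧ p < ∞) (f : ℝ → ℝ≥0∞) (A : Set ℝ) :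
    normOn p f A = lpOn p.toReal f A := by
  rw [normOn, lpOn, eLpNorm_eq_lintegral_rpow_enorm_toReal hp.1.ne' hp.2.ne]
  simp

theorem lpOn_mono {p : ℝ} (hp : 0 < p) (f : ℝ → ℝ≥0∞) {A B : Set ℝ} (h : A ⊆ B) :
    lpOn p f A ≤ lpOn p f B := by
  rw [lpOn, lpOn]
  gcongr

theorem lintegral_indicator_Ioi_mul {q : ℝ} (hq : 0 < q) {u : ℝ → ℝ≥0∞}
    (hu : AEMeasurable u (volume.restrict (Ioi 0))) {a : ℝ} (ha : 0 ≤ a) (c d : ℝ≥0∞) :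
    ∫⁻ t in Ioi 0, (Ioi a).indicator (fun _ => (c * d) ^ q) t * u t ^ q =
      (c * lpOn q u (Ioi a) * d) ^ q := by
  have hsub : Ioi a ⊆ Ioi 0 := Ioi_subset_Ioi ha
  have e : ∀ t, (Ioi a).indicator (fun _ => (c * d) ^ q) t * u t ^ q =
      (Ioi a).indicator (fun t => (c * d) ^ q * u t ^ q) t := fun t => by
    simp only [indicator]
    split_ifs <;> simp
  simp only [e]
  rw [lintegral_indicator measurableSet_Ioi, Measure.restrict_restrict measurableSet_Ioi,
    inter_eq_left.2 hsub, lintegral_const_mul'' _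
      ((hu.mono_measure (Measure.restrict_mono hsub le_rfl)).pow_const q),
    ← lpOn_rpow hq, ← ENNReal.mul_rpow_of_nonneg _ _ hq.le]
  congr 1
  ring

/-- A strictly increasing sequence `x k`, `k ∈ ℤ`, of points of `(0,∞)` that exhausts `(0,∞)` and
satisfies `‖ω‖_{r,(0,x k)} = 2 ^ k`. -/
structure DyadicMesh (r : ℝ) (ω : ℝ → ℝ≥0∞) (x : ℤ → ℝ) : Prop where
  strictMono : StrictMono x
  pos : ∀ k, 0 < x k
  exists_mem : ∀ t, 0 < t → ∃ k, t ∈ Ioc (x k) (x (k + 1))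
  lpOn_eq : ∀ k, lpOn r ω (Ioo 0 (x k)) = 2 ^ k

namespace DyadicMesh

variable {r : ℝ} {ω : ℝ → ℝ≥0∞} {x : ℤ → ℝ}

theorem disjoint (hx : DyadicMesh r ω x) :
    Pairwise (Function.onFun Disjoint fun k => Ioc (x k) (x (k + 1))) := by
  exact hx.strictMono.monotone.pairwise_disjoint_on_Ioc_succ

theorem iUnion_eq (hx : DyadicMesh r ω x) : ⋃ k, Ioc (x k) (x (k + 1)) = Ioi 0 := by
  ext t
  simp only [mem_iUnion]
  exact ⟨fun ⟨k, hk⟩ => (hx.pos k).trans hk.1, hx.exists_mem t⟩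

theorem lintegral_Ioi (hx : DyadicMesh r ω x) (g : ℝ → ℝ≥0∞) :
    ∫⁻ t in Ioi 0, g t = ∑' k, ∫⁻ t in Ioc (x k) (x (k + 1)), g t := by
  rw [← hx.iUnion_eq, lintegral_iUnion (fun _ => measurableSet_Ioc) hx.disjoint]

end DyadicMesh

/-- Hölder's inequality on a block of the mesh. -/
theorem DyadicMesh.lpOn_Ioc_le {r : ℝ} {ω : ℝ → ℝ≥0∞} {x : ℤ → ℝ} (hx : DyadicMesh r ω x)
    {p₁ p₂ : ℝ} (hp₂ : 0 < p₂) (hp : p₂ < p₁) (hr0 : 0 < r) (hr : 1 / p₂ = 1 / p₁ + 1 / r)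
    {φ : ℝ → ℝ≥0∞} (hφ : AEMeasurable φ (volume.restrict (Ioi 0)))
    (hω : AEMeasurable ω (volume.restrict (Ioi 0))) (k : ℤ) :
    lpOn p₂ (fun s => φ s * ω s) (Ioc (x k) (x (k + 1))) ≤
      2 * (2 ^ k * lpOn p₁ φ (Ioc (x k) (x (k + 1)))) := by
  have hsub : Ioc (x k) (x (k + 1)) ⊆ Ioi 0 := fun t ht => (hx.pos k).trans ht.1
  have h := ENNReal.lintegral_Lp_mul_le_Lq_mul_Lr hp₂ hp hr
    (volume.restrict (Ioc (x k) (x (k + 1)))) (f := φ) (g := ω)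
    (hφ.mono_measure (Measure.restrict_mono hsub le_rfl))
    (hω.mono_measure (Measure.restrict_mono hsub le_rfl))
  have hle : lpOn r ω (Ioc (x k) (x (k + 1))) ≤ 2 * 2 ^ k := by
    rw [← two_zpow_add_one, ← hx.lpOn_eq (k + 1), lpOn, lpOn, ← restrict_Ioo_eq_restrict_Ioc]
    gcongr
    exact (hx.pos k).le
  calc _ ≤ lpOn p₁ φ (Ioc (x k) (x (k + 1))) * lpOn r ω (Ioc (x k) (x (k + 1))) := h
    _ ≤ lpOn p₁ φ (Ioc (x k) (x (k + 1))) * (2 * 2 ^ k) := by gcongr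
    _ = _ := by ring

/-- A Hardy inequality for functions carried by the blocks with index in `S`: the weighted norms of
the primitive are controlled by the `L^{p₁}` norm as soon as the multiplier
`2 ^ k ‖u‖_{q₂,(x k,∞)}`, `k ∈ S`, maps `ℓ^{p₁}` to `ℓ^{q₂}`. Only the indices in `S` enter the
hypothesis because the primitive is constant beyond the last block of `S`. -/
theorem DyadicMesh.hardy {r : ℝ} {ω : ℝ → ℝ≥0∞} {x : ℤ → ℝ} (hx : DyadicMesh r ω x)
    {p₁ p₂ q₂ : ℝ} (hp₂ : 0 < p₂) (hp : p₂ < p₁) (hr0 : 0 < r) (hr : 1 / p₂ = 1 / p₁ + 1 / r)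
    (hpq : p₂ < q₂)
    {φ : ℝ → ℝ≥0∞} (hφ : AEMeasurable φ (volume.restrict (Ioi 0)))
    (hω : AEMeasurable ω (volume.restrict (Ioi 0)))
    {u : ℝ → ℝ≥0∞} (hu : AEMeasurable u (volume.restrict (Ioi 0)))
    (S : Set ℤ) (hS : ∀ k ∉ S, ∀ s ∈ Ioc (x k) (x (k + 1)), φ s = 0) {D : ℝ≥0∞}
    (hD : ∀ y : ℤ → ℝ≥0∞, (∑' k : S, (2 ^ (k : ℤ) * lpOn q₂ u (Ioi (x k)) * y k) ^ q₂) ^ (1 / q₂) ≤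
      D * (∑' k : ℤ, y k ^ p₁) ^ (1 / p₁)) :
    lpOn q₂ (fun t => lpOn p₂ (fun s => φ s * ω s) (Ioo 0 t) * u t) (Ioi 0) ≤
      2 * geomConst p₂ ^ (1 / p₂) * (D * lpOn p₁ φ (Ioi 0)) := by
  have hq₂ : 0 < q₂ := hp₂.trans hpq
  have hp₁ : 0 < p₁ := hp₂.trans hp
  set a : ℤ → ℝ≥0∞ := fun k => lpOn p₁ φ (Ioc (x k) (x (k + 1))) with ha
  set b : ℤ → ℝ≥0∞ := fun k => (2 ^ k * a k) ^ p₂ with hb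
  set y : ℤ → ℝ≥0∞ := fun k => (∑' i : ℕ, ((2 : ℝ≥0∞) ^ (-p₂)) ^ i * a (k - i) ^ p₂) ^ (1 / p₂)
    with hy
  -- `y k` collects the blocks up to the `k`-th one, rescaled by `2 ^ (-k)`
  have hby : ∀ k : ℤ, ∑' i : ℕ, b (k - i) = (2 ^ k * y k) ^ p₂ := fun k => by
    rw [ENNReal.mul_rpow_of_nonneg _ _ hp₂.le, hy]
    dsimp only
    rw [← ENNReal.rpow_mul, one_div_mul_cancel hp₂.ne', ENNReal.rpow_one, ← ENNReal.tsum_mul_left]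
    refine tsum_congr fun i => ?_
    rw [hb]
    dsimp only
    rw [ENNReal.mul_rpow_of_nonneg _ _ hp₂.le, two_zpow_sub_nat_rpow, mul_assoc]
  -- blocks outside `S` do not contribute
  have ha0 : ∀ k ∉ S, ∀ t, ∫⁻ s in Ioc (x k) (x (k + 1)) ∩ Iio t, (φ s * ω s) ^ p₂ = 0 := by
    intro k hk t
    rw [setLIntegral_congr_fun (g := fun _ => 0) (measurableSet_Ioc.inter measurableSet_Iio)
      (fun s hs => ?_), lintegral_zero]
    simp [hS k hk s hs.1, hp₂]
  -- the inner norm at `t` only sees the blocks that start before `t`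
  have hinner : ∀ t, lpOn p₂ (fun s => φ s * ω s) (Ioo 0 t) ^ q₂ ≤
      2 ^ q₂ * ∑' k : S, (Ioi (x k)).indicator (fun _ => (2 ^ (k : ℤ) * y k) ^ q₂) t := by
    intro t
    have h1 : lpOn p₂ (fun s => φ s * ω s) (Ioo 0 t) ^ p₂ ≤
        2 ^ p₂ * ∑' k : {k : ℤ | k ∈ S ∧ x k < t}, b k := by
      rw [lpOn_rpow hp₂]
      calc _ = ∑' k, ∫⁻ s in Ioc (x k) (x (k + 1)) ∩ Iio t, (φ s * ω s) ^ p₂ := by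
            rw [← lintegral_iUnion (fun _ => measurableSet_Ioc.inter measurableSet_Iio)
              (fun i j hij => (hx.disjoint hij).mono inter_subset_left inter_subset_left),
              ← iUnion_inter, hx.iUnion_eq, Ioi_inter_Iio]
        _ = ∑' k : {k : ℤ | k ∈ S ∧ x k < t},
              ∫⁻ s in Ioc (x k) (x (k + 1)) ∩ Iio t, (φ s * ω s) ^ p₂ := by
            rw [tsum_subtype {k : ℤ | k ∈ S ∧ x k < t}
              (fun k => ∫⁻ s in Ioc (x k) (x (k + 1)) ∩ Iio t, (φ s * ω s) ^ p₂)]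
            refine tsum_congr fun k => ?_
            by_cases hk : k ∈ {k : ℤ | k ∈ S ∧ x k < t}
            · rw [indicator_of_mem hk]
            · rw [indicator_of_notMem hk]
              by_cases hkS : k ∈ S
              · have : t ≤ x k := not_lt.1 fun h => hk ⟨hkS, h⟩
                rw [(_ : Ioc (x k) (x (k + 1)) ∩ Iio t = ∅)]
                · simp
                · ext s
                  simp only [mem_inter_iff, mem_Ioc, mem_Iio, mem_empty_iff_false, iff_false]
                  intro hs
                  linarith [hs.1.1, hs.2]
              · exact ha0 k hkS t
        _ ≤ _ := by
            rw [← ENNReal.tsum_mul_left]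
            refine ENNReal.tsum_le_tsum fun k => ?_
            rw [hb]
            dsimp only
            rw [← ENNReal.mul_rpow_of_nonneg _ _ hp₂.le]
            calc _ ≤ ∫⁻ s in Ioc (x k) (x (k + 1)), (φ s * ω s) ^ p₂ :=
                  lintegral_mono_set inter_subset_left
              _ = lpOn p₂ (fun s => φ s * ω s) (Ioc (x k) (x (k + 1))) ^ p₂ :=
                  (lpOn_rpow hp₂ _ _).symm
              _ ≤ _ := by
                  gcongr
                  exact hx.lpOn_Ioc_le hp₂ hp hr0 hr hφ hω k
    have h2 := ENNReal.rpow_le_rpow h1 (z := q₂ / p₂) (by positivity)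
    rw [ENNReal.mul_rpow_of_nonneg _ _ (by positivity), ← ENNReal.rpow_mul, ← ENNReal.rpow_mul,
      mul_div_cancel₀ q₂ hp₂.ne'] at h2
    refine h2.trans ?_
    gcongr
    refine (rpow_tsum_le_tsum_rpow_partial _ b (β := q₂ / p₂) (by positivity)).trans (le_of_eq ?_)
    rw [tsum_subtype {k : ℤ | k ∈ S ∧ x k < t} (fun k => (∑' i : ℕ, b (k - i)) ^ (q₂ / p₂)),
      tsum_subtype S (fun k => (Ioi (x k)).indicator (fun _ => (2 ^ (k : ℤ) * y k) ^ q₂) t)]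
    refine tsum_congr fun k => ?_
    simp only [indicator, hby, mem_Ioi]
    rw [← ENNReal.rpow_mul, mul_div_cancel₀ q₂ hp₂.ne']
    have hmem : k ∈ {k : ℤ | k ∈ S ∧ x k < t} ↔ k ∈ S ∧ x k < t := Iff.rfl
    split_ifs <;> first | rfl | (exfalso; tauto)
  -- Young's inequality: `y ^ p₂` is the convolution of `a ^ p₂` with a geometric sequence
  have hY : (∑' k : ℤ, y k ^ p₁) ^ (1 / p₁) ≤ geomConst p₂ ^ (1 / p₂) * lpOn p₁ φ (Ioi 0) := by
    have h := tsum_rpow_geometric_le (fun k => a k ^ p₂) ((2 : ℝ≥0∞) ^ (-p₂)) (s := p₁ / p₂)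
      ((one_le_div hp₂).2 hp.le)
    simp only [← ENNReal.rpow_mul, mul_div_cancel₀ p₁ hp₂.ne'] at h
    have h' := ENNReal.rpow_le_rpow h (z := 1 / p₂) (by positivity)
    rw [ENNReal.mul_rpow_of_nonneg _ _ (by positivity), ← ENNReal.rpow_mul, ← ENNReal.rpow_mul] at h'
    have e1 : 1 / (p₁ / p₂) * (1 / p₂) = 1 / p₁ := by field_simp
    rw [e1] at h'
    have e2 : ∑' k, a k ^ p₁ = ∫⁻ s in Ioi 0, φ s ^ p₁ := by
      rw [hx.lintegral_Ioi]
      exact tsum_congr fun k => lpOn_rpow hp₁ _ _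
    rw [e2] at h'
    refine le_trans (le_of_eq ?_) h'
    congr 1
    refine tsum_congr fun k => ?_
    rw [hy]
    dsimp only
    rw [← ENNReal.rpow_mul]
    congr 1
    field_simp
  have hmain : ∫⁻ t in Ioi 0, (lpOn p₂ (fun s => φ s * ω s) (Ioo 0 t) * u t) ^ q₂ ≤
      2 ^ q₂ * ∑' k : S, (2 ^ (k : ℤ) * lpOn q₂ u (Ioi (x k)) * y k) ^ q₂ := by
    have hm : ∀ k : S, AEMeasurable (fun t => (Ioi (x k)).indicator
        (fun _ => (2 ^ (k : ℤ) * y k) ^ q₂) t * u t ^ q₂) (volume.restrict (Ioi 0)) := fun k =>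
      ((measurable_const.indicator measurableSet_Ioi).aemeasurable).mul (hu.pow_const q₂)
    calc _ ≤ ∫⁻ t in Ioi 0, 2 ^ q₂ * ∑' k : S, (Ioi (x k)).indicator
              (fun _ => (2 ^ (k : ℤ) * y k) ^ q₂) t * u t ^ q₂ := by
          refine lintegral_mono fun t => ?_
          dsimp only
          rw [ENNReal.mul_rpow_of_nonneg _ _ hq₂.le, ENNReal.tsum_mul_right, ← mul_assoc]
          gcongr
          exact hinner t
      _ = 2 ^ q₂ * ∑' k : S, ∫⁻ t in Ioi 0, (Ioi (x k)).indicator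
              (fun _ => (2 ^ (k : ℤ) * y k) ^ q₂) t * u t ^ q₂ := by
          rw [lintegral_const_mul'' _ (AEMeasurable.tsum hm), lintegral_tsum hm]
      _ = _ := by
          congr 1
          exact tsum_congr fun k => lintegral_indicator_Ioi_mul hq₂ hu (hx.pos k).le _ _
  calc _ ≤ (2 ^ q₂ * ∑' k : S, (2 ^ (k : ℤ) * lpOn q₂ u (Ioi (x k)) * y k) ^ q₂) ^ (1 / q₂) := by
        rw [lpOn]
        gcongr
    _ = 2 * (∑' k : S, (2 ^ (k : ℤ) * lpOn q₂ u (Ioi (x k)) * y k) ^ q₂) ^ (1 / q₂) := by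
        rw [ENNReal.mul_rpow_of_nonneg _ _ (by positivity), ← ENNReal.rpow_mul,
          mul_one_div_cancel hq₂.ne', ENNReal.rpow_one]
    _ ≤ 2 * (D * (geomConst p₂ ^ (1 / p₂) * lpOn p₁ φ (Ioi 0))) := by
        gcongr
        exact (hD y).trans (by gcongr)
    _ = _ := by ring

/-! ### From the discrete inequality to the embedding -/

/-- The intermediate value theorem for the primitive of a nonnegative function on `(0,∞)`. -/
theorem exists_setLIntegral_Ioo_eq {g : ℝ → ℝ≥0∞} (hg : AEMeasurable g (volume.restrict (Ioi 0)))
    {s : ℝ} (hs : 0 < s) (hfin : ∫⁻ x in Ioo 0 s, g x ≠ ∞) {y : ℝ≥0∞} (hy0 : 0 < y)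
    (hy : y ≤ ∫⁻ x in Ioo 0 s, g x) : ∃ t, 0 < t ∧ t ≤ s ∧ ∫⁻ x in Ioo 0 t, g x = y := by
  have hgt : ∀ t, AEMeasurable g (volume.restrict (Ioc 0 t)) := fun t =>
    hg.mono_measure (Measure.restrict_mono Ioc_subset_Ioi_self le_rfl)
  have hfin' : ∀ t ≤ s, ∫⁻ x in Ioc 0 t, g x ≠ ∞ := fun t ht => by
    rw [← restrict_Ioo_eq_restrict_Ioc]
    exact ne_top_of_le_ne_top hfin (lintegral_mono_set (Ioo_subset_Ioo_right ht))
  have hint : IntegrableOn (fun x => (g x).toReal) (uIcc 0 s) := by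
    rw [uIcc_of_le hs.le, integrableOn_Icc_iff_integrableOn_Ioc]
    exact integrable_toReal_of_lintegral_ne_top (hgt s) (hfin' s le_rfl)
  have hval : ∀ t, 0 ≤ t → t ≤ s →
      ∫ x in (0 : ℝ)..t, (g x).toReal = (∫⁻ x in Ioo 0 t, g x).toReal := fun t ht0 hts => by
    rw [intervalIntegral.integral_of_le ht0, restrict_Ioo_eq_restrict_Ioc,
      integral_toReal (hgt t) (ae_lt_top' (hgt t) (hfin' t hts))]
  have hcont := intervalIntegral.continuousOn_primitive_interval hint
  rw [uIcc_of_le hs.le] at hcont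
  have hmem : y.toReal ∈ Icc (∫ x in (0 : ℝ)..0, (g x).toReal) (∫ x in (0 : ℝ)..s, (g x).toReal) := by
    rw [hval s hs.le le_rfl, intervalIntegral.integral_same]
    exact ⟨ENNReal.toReal_nonneg, ENNReal.toReal_mono hfin hy⟩
  obtain ⟨t, ht, hty⟩ := intermediate_value_Icc hs.le hcont hmem
  dsimp only at hty
  rw [hval t ht.1 ht.2] at hty
  have hyt : y ≠ ∞ := ne_top_of_le_ne_top hfin hy
  have heq : ∫⁻ x in Ioo 0 t, g x = y := by
    refine (ENNReal.toReal_eq_toReal_iff' ?_ hyt).1 hty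
    exact ne_top_of_le_ne_top hfin (lintegral_mono_set (Ioo_subset_Ioo_right ht.2))
  refine ⟨t, lt_of_le_of_ne ht.1 ?_, ht.2, heq⟩
  rintro rfl
  simp only [Ioo_self, Measure.restrict_empty, lintegral_zero_measure] at heq
  exact hy0.ne heq

theorem exists_lpOn_Ioo_eq {q : ℝ} (hq : 0 < q) {u : ℝ → ℝ≥0∞}
    (hu : AEMeasurable u (volume.restrict (Ioi 0))) {s : ℝ} (hs : 0 < s)
    (hfin : lpOn q u (Ioo 0 s) ≠ ∞) {y : ℝ≥0∞} (hy0 : 0 < y) (hy : y ≤ lpOn q u (Ioo 0 s)) :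
    ∃ t, 0 < t ∧ t ≤ s ∧ lpOn q u (Ioo 0 t) = y := by
  obtain ⟨t, ht0, hts, ht⟩ := exists_setLIntegral_Ioo_eq (g := fun x => u x ^ q) (y := y ^ q)
    (hu.pow_const q) hs
    (by rw [← lpOn_rpow hq]; exact ENNReal.rpow_ne_top_of_nonneg hq.le hfin)
    (ENNReal.rpow_pos_of_nonneg hy0 hq.le)
    (by rw [← lpOn_rpow hq]; gcongr)
  refine ⟨t, ht0, hts, ?_⟩
  rw [lpOn, ht, ← ENNReal.rpow_mul, mul_one_div_cancel hq.ne', ENNReal.rpow_one]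

theorem monotone_lpOn_Ioo {q : ℝ} (hq : 0 < q) (u : ℝ → ℝ≥0∞) :
    Monotone fun t => lpOn q u (Ioo 0 t) :=
  fun _ _ h => lpOn_mono hq u (Ioo_subset_Ioo_right h)

/-- The part of the half-line on which the primitive norm `‖u‖_{q,(0,t)}` is of order `2 ^ n`. -/
def levelSet (q : ℝ) (u : ℝ → ℝ≥0∞) (n : ℤ) : Set ℝ :=
  {t | 0 < t ∧ lpOn q u (Ioo 0 t) ∈ Ioc ((2 : ℝ≥0∞) ^ n) (2 ^ (n + 1))}

section levelSet

variable {q : ℝ} {u : ℝ → ℝ≥0∞}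

theorem measurableSet_levelSet (hq : 0 < q) (n : ℤ) : MeasurableSet (levelSet q u n) :=
  measurableSet_Ioi.inter ((monotone_lpOn_Ioo hq u).measurable measurableSet_Ioc)

theorem disjoint_levelSet : Pairwise (Function.onFun Disjoint (levelSet q u)) := by
  have hmono : Monotone fun k : ℤ => (2 : ℝ≥0∞) ^ k := fun a b h =>
    ENNReal.zpow_le_of_le (by norm_num) h
  intro m n hmn
  refine disjoint_left.2 fun t hm hn => ?_
  exact disjoint_left.1 (hmono.pairwise_disjoint_on_Ioc_succ hmn) hm.2 hn.2

theorem iUnion_levelSet (hu : ∀ t, 0 < t → 0 < lpOn q u (Ioo 0 t) ∧ lpOn q u (Ioo 0 t) < ∞) :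
    ⋃ n, levelSet q u n = Ioi 0 := by
  ext t
  simp only [mem_iUnion]
  refine ⟨fun ⟨n, hn⟩ => hn.1, fun ht => ?_⟩
  obtain ⟨n, hn⟩ := ENNReal.exists_mem_Ioc_zpow (hu t ht).1.ne' (hu t ht).2.ne
    (y := 2) (by norm_num) (by norm_num)
  exact ⟨n, ht, hn⟩

/-- The sum over the level sets of the weighted norms is controlled by the Copson functional. -/
theorem tsum_levelSet_le (hq : 0 < q) (hum : AEMeasurable u (volume.restrict (Ioi 0)))
    (hu : ∀ t, 0 < t → 0 < lpOn q u (Ioo 0 t) ∧ lpOn q u (Ioo 0 t) < ∞)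
    {p : ℝ} (hp : 0 < p) (φ : ℝ → ℝ≥0∞) :
    ∑' n, (2 ^ n * lpOn p φ (levelSet q u n)) ^ q ≤
      geomConst q * ∫⁻ t in Ioi 0, (lpOn p φ (Ioi t) * u t) ^ q := by
  -- `τ n` is a point where the primitive norm equals `2 ^ n`; if the primitive norm is bounded there
  -- is such a point only for `n` up to some index, and other values of `τ` are never used
  have hex : ∀ n, ∃ t, (∃ m, n ≤ m ∧ (levelSet q u m).Nonempty) →
      0 < t ∧ lpOn q u (Ioo 0 t) = 2 ^ n := fun n => by
    by_cases h : ∃ m, n ≤ m ∧ (levelSet q u m).Nonempty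
    · obtain ⟨m, hnm, s, hs⟩ := h
      obtain ⟨t, ht0, -, ht⟩ := exists_lpOn_Ioo_eq hq hum hs.1 (hu s hs.1).2.ne (two_zpow_pos n)
        ((ENNReal.zpow_le_of_le (by norm_num) hnm).trans hs.2.1.le)
      exact ⟨t, fun _ => ⟨ht0, ht⟩⟩
    · exact ⟨0, fun h' => absurd h' h⟩
  choose τ hτ using hex
  set N : Set ℤ := {n | (levelSet q u n).Nonempty} with hN
  have hτ1 : ∀ n ∈ N, 0 < τ n ∧ lpOn q u (Ioo 0 (τ n)) = 2 ^ n := fun n hn =>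
    hτ n ⟨n, le_rfl, hn⟩
  have hτ2 : ∀ n ∈ N, 0 < τ (n - 1) ∧ lpOn q u (Ioo 0 (τ (n - 1))) = 2 ^ (n - 1) := fun n hn =>
    hτ (n - 1) ⟨n, by omega, hn⟩
  have hlt : ∀ {s t : ℝ}, lpOn q u (Ioo 0 s) < lpOn q u (Ioo 0 t) → s < t := fun h =>
    (monotone_lpOn_Ioo hq u).reflect_lt h
  have hpow : ∀ {m n : ℤ}, m < n → (2 : ℝ≥0∞) ^ m < 2 ^ n := fun {m n} h => by
    refine lt_of_lt_of_le ?_ (ENNReal.zpow_le_of_le (by norm_num) (Int.add_one_le_of_lt h))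
    rw [two_zpow_add_one, two_mul]
    exact ENNReal.lt_add_right (two_zpow_ne_top m) (two_zpow_pos m).ne'
  -- the mass of `u ^ q` between `τ (n - 1)` and `τ n` is comparable to `2 ^ (n q)`
  have hmass : ∀ n ∈ N, ((2 : ℝ≥0∞) ^ n) ^ q =
      geomConst q * ∫⁻ t in Ioc (τ (n - 1)) (τ n), u t ^ q := fun n hn => by
    have hle : τ (n - 1) < τ n := hlt (by rw [(hτ1 n hn).2, (hτ2 n hn).2]; exact hpow (by omega))
    refine eq_geomConst_mul_of_eq_add hq
      (ENNReal.rpow_ne_top_of_nonneg hq.le (two_zpow_ne_top n)) ?_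
    have h1 : ((2 : ℝ≥0∞) ^ n) ^ q = ∫⁻ t in Ioc 0 (τ n), u t ^ q := by
      rw [← (hτ1 n hn).2, lpOn_rpow hq, restrict_Ioo_eq_restrict_Ioc]
    have h2 : 2 ^ (-q) * ((2 : ℝ≥0∞) ^ n) ^ q = ∫⁻ t in Ioc 0 (τ (n - 1)), u t ^ q := by
      rw [← restrict_Ioo_eq_restrict_Ioc, ← lpOn_rpow hq, (hτ2 n hn).2]
      have := two_zpow_sub_nat_rpow n 1 q
      rw [pow_one, Nat.cast_one] at this
      rw [this, mul_comm]
    rw [h2, h1, add_comm, ← lintegral_union measurableSet_Ioc (Ioc_disjoint_Ioc_of_le le_rfl),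
      Ioc_union_Ioc_eq_Ioc (hτ2 n hn).1.le hle.le]
  have hdisj : Pairwise (Function.onFun Disjoint fun n : N => Ioc (τ (n - 1)) (τ n)) := by
    have hle : ∀ m n : N, (m : ℤ) < n → Disjoint (Ioc (τ (m - 1)) (τ m)) (Ioc (τ (n - 1)) (τ n)) := by
      intro m n hmn
      refine Ioc_disjoint_Ioc_of_le ?_
      rcases eq_or_lt_of_le (Int.le_sub_one_of_lt hmn) with h | h
      · rw [← h]
      · refine (hlt ?_).le
        rw [(hτ1 m m.2).2, (hτ2 n n.2).2]
        exact hpow h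
    intro m n hmn
    rcases lt_or_gt_of_ne (fun h => hmn (Subtype.ext h) : (m : ℤ) ≠ n) with h | h
    · exact hle m n h
    · exact (hle n m h).symm
  calc _ = ∑' n : N, (2 ^ (n : ℤ) * lpOn p φ (levelSet q u n)) ^ q := by
        rw [tsum_subtype N (fun n => (2 ^ (n : ℤ) * lpOn p φ (levelSet q u n)) ^ q)]
        refine tsum_congr fun n => ?_
        by_cases hn : n ∈ N
        · rw [indicator_of_mem hn]
        · rw [indicator_of_notMem hn, not_nonempty_iff_eq_empty.1 hn]
          simp [lpOn, hp, hq]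
    _ ≤ ∑' n : N, geomConst q *
          ∫⁻ t in Ioc (τ (n - 1)) (τ n), (lpOn p φ (Ioi t) * u t) ^ q := by
        refine ENNReal.tsum_le_tsum fun n => ?_
        rw [ENNReal.mul_rpow_of_nonneg _ _ hq.le, hmass n n.2, mul_assoc]
        gcongr
        have hsub : Ioc (τ (n - 1)) (τ n) ⊆ Ioi 0 := fun t ht => (hτ2 n n.2).1.trans ht.1
        rw [← lintegral_mul_const'' _
          ((hum.mono_measure (Measure.restrict_mono hsub le_rfl)).pow_const q)]
        refine setLIntegral_mono' measurableSet_Ioc fun t ht => ?_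
        rw [ENNReal.mul_rpow_of_nonneg _ _ hq.le, mul_comm]
        gcongr
        refine lpOn_mono hp φ fun s hs => ?_
        refine lt_of_le_of_lt ht.2 (hlt ?_)
        rw [(hτ1 n n.2).2]
        exact hs.2.1
    _ = geomConst q * ∫⁻ t in ⋃ n : N, Ioc (τ (n - 1)) (τ n), (lpOn p φ (Ioi t) * u t) ^ q := by
        rw [ENNReal.tsum_mul_left, lintegral_iUnion (fun _ => measurableSet_Ioc) hdisj]
    _ ≤ _ := by
        gcongr
        exact iUnion_subset fun n t ht => (hτ2 n n.2).1.trans ht.1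

end levelSet

/-- The Cesàro functional is `p`-subadditive over a decomposition of the half-line when `p ≤ q`. -/
theorem lpOn_cesaro_le_tsum {p q : ℝ} (hp : 0 < p) (hpq : p ≤ q) {E : ℤ → Set ℝ}
    (hE : ∀ n, MeasurableSet (E n)) (hEd : Pairwise (Function.onFun Disjoint E))
    (hEu : ⋃ n, E n = Ioi 0) (ψ : ℝ → ℝ≥0∞) {u : ℝ → ℝ≥0∞}
    (hu : AEMeasurable u (volume.restrict (Ioi 0))) :
    lpOn q (fun t => lpOn p ψ (Ioo 0 t) * u t) (Ioi 0) ≤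
      (∑' n, lpOn q (fun t => lpOn p ((E n).indicator ψ) (Ioo 0 t) * u t) (Ioi 0) ^ p) ^ (1 / p) := by
  have hq : 0 < q := hp.trans_le hpq
  have hsplit : ∀ t, lpOn p ψ (Ioo 0 t) ^ p = ∑' n, lpOn p ((E n).indicator ψ) (Ioo 0 t) ^ p := by
    intro t
    simp only [lpOn_rpow hp]
    have : ∀ n s, (E n).indicator ψ s ^ p = (E n).indicator (fun s => ψ s ^ p) s := fun n s => by
      simp only [indicator]
      split_ifs <;> simp [hp]
    simp only [this]
    simp only [lintegral_indicator (hE _), Measure.restrict_restrict (hE _)]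
    rw [← lintegral_iUnion (fun n => (hE n).inter measurableSet_Ioo)
      (fun i j hij => (hEd hij).mono inter_subset_left inter_subset_left), ← iUnion_inter, hEu,
      inter_eq_right.2 Ioo_subset_Ioi_self]
  have h := lintegral_rpow_tsum_le (μ := volume.restrict (Ioi 0)) (s := q / p)
    (φ := fun (n : ℤ) t => (lpOn p ((E n).indicator ψ) (Ioo 0 t) * u t) ^ p)
    (fun n => ((monotone_lpOn_Ioo hp _).measurable.aemeasurable.mul hu).pow_const p)
    ((one_le_div hp).2 hpq)
  have h' := ENNReal.rpow_le_rpow h (z := 1 / p) (by positivity)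
  refine le_trans (le_of_eq ?_) (h'.trans (le_of_eq ?_))
  · rw [lpOn, ← ENNReal.rpow_mul]
    congr 1
    · refine lintegral_congr fun t => ?_
      simp only [ENNReal.mul_rpow_of_nonneg _ _ hp.le]
      rw [ENNReal.tsum_mul_right, ← hsplit, ← ENNReal.mul_rpow_of_nonneg _ _ hp.le,
        ← ENNReal.rpow_mul, mul_div_cancel₀ q hp.ne']
    · field_simp
  · congr 1
    refine tsum_congr fun n => ?_
    rw [lpOn, ← ENNReal.rpow_mul]
    congr 1
    · refine lintegral_congr fun t => ?_
      rw [← ENNReal.rpow_mul, mul_div_cancel₀ q hp.ne']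
    · field_simp

/-- If the discrete inequality
`‖2 ^ k ‖u₂‖_{q₂,(x k,∞)} y k‖_{ℓ^{q₂}(k ≤ K)} ≤ A ‖u₁‖_{q₁,(0,x K)} ‖y‖_{ℓ^{p₁}}` holds, then the
Cesàro functional is dominated by the Copson functional. -/
theorem DyadicMesh.cesaro_le_copson {r : ℝ} {ω : ℝ → ℝ≥0∞} {x : ℤ → ℝ} (hx : DyadicMesh r ω x)
    {p₁ p₂ q₁ q₂ : ℝ} (hp₂ : 0 < p₂) (hp : p₂ < p₁) (hr0 : 0 < r) (hr : 1 / p₂ = 1 / p₁ + 1 / r)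
    (hq₁ : 0 < q₁) (hqp : q₁ ≤ p₂) (hpq : p₂ < q₂)
    {φ : ℝ → ℝ≥0∞} (hφ : AEMeasurable φ (volume.restrict (Ioi 0)))
    (hω : AEMeasurable ω (volume.restrict (Ioi 0)))
    {u₁ : ℝ → ℝ≥0∞} (hu₁m : AEMeasurable u₁ (volume.restrict (Ioi 0)))
    (hu₁ : ∀ t, 0 < t → 0 < lpOn q₁ u₁ (Ioo 0 t) ∧ lpOn q₁ u₁ (Ioo 0 t) < ∞)
    {u₂ : ℝ → ℝ≥0∞} (hu₂ : AEMeasurable u₂ (volume.restrict (Ioi 0))) {A : ℝ≥0∞}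
    (hA : ∀ (K : ℤ) (y : ℤ → ℝ≥0∞),
      (∑' k : Iic K, (2 ^ (k : ℤ) * lpOn q₂ u₂ (Ioi (x k)) * y k) ^ q₂) ^ (1 / q₂) ≤
        A * lpOn q₁ u₁ (Ioo 0 (x K)) * (∑' k : ℤ, y k ^ p₁) ^ (1 / p₁)) :
    lpOn q₂ (fun t => lpOn p₂ (fun s => φ s * ω s) (Ioo 0 t) * u₂ t) (Ioi 0) ≤
      4 * geomConst p₂ ^ (1 / p₂) * geomConst q₁ ^ (1 / q₁) *
        (A * lpOn q₁ (fun t => lpOn p₁ φ (Ioi t) * u₁ t) (Ioi 0)) := by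
  have hq₂ : 0 < q₂ := hp₂.trans hpq
  have hp₁ : 0 < p₁ := hp₂.trans hp
  set E := levelSet q₁ u₁ with hE
  have hEm : ∀ n, MeasurableSet (E n) := measurableSet_levelSet hq₁
  have hpiece : ∀ n, lpOn q₂ (fun t => lpOn p₂ ((E n).indicator fun s => φ s * ω s) (Ioo 0 t) * u₂ t)
      (Ioi 0) ≤ 4 * geomConst p₂ ^ (1 / p₂) * A * (2 ^ n * lpOn p₁ φ (E n)) := by
    intro n
    have h := hx.hardy hp₂ hp hr0 hr hpq (φ := (E n).indicator φ) (hφ.indicator (hEm n)) hω hu₂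
      {k | ∃ s ∈ E n, x k < s} (fun k hk s hs => indicator_of_notMem (fun hsE => hk ⟨s, hsE, hs.1⟩) _)
      (D := A * 2 ^ (n + 1)) (fun y => ?_)
    · have e1 : ∀ s, (E n).indicator φ s * ω s = (E n).indicator (fun s => φ s * ω s) s := fun s => by
        simp only [indicator]
        split_ifs <;> simp
      have e2 : lpOn p₁ ((E n).indicator φ) (Ioi 0) = lpOn p₁ φ (E n) := by
        have : ∀ s, (E n).indicator φ s ^ p₁ = (E n).indicator (fun s => φ s ^ p₁) s := fun s => by
          simp only [indicator]
          split_ifs <;> simp [hp₁]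
        rw [lpOn, lpOn]
        simp only [this]
        rw [lintegral_indicator (hEm n), Measure.restrict_restrict (hEm n),
          inter_eq_left.2 (fun s hs => hs.1)]
      simp only [e1] at h
      rw [e2, two_zpow_add_one] at h
      refine h.trans (le_of_eq ?_)
      ring
    · rw [one_div, ENNReal.rpow_inv_le_iff hq₂]
      refine tsum_subtype_le_of_forall_tsum_Iic_le _
        (fun k => (2 ^ k * lpOn q₂ u₂ (Ioi (x k)) * y k) ^ q₂) fun K hK => ?_
      obtain ⟨s, hs, hKs⟩ := hK
      rw [← ENNReal.rpow_inv_le_iff hq₂, ← one_div]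
      refine (hA K y).trans ?_
      gcongr
      exact (monotone_lpOn_Ioo hq₁ u₁ hKs.le).trans hs.2.2
  calc _ ≤ _ := lpOn_cesaro_le_tsum hp₂ hpq.le hEm disjoint_levelSet (iUnion_levelSet hu₁) _ hu₂
    _ ≤ (∑' n, (4 * geomConst p₂ ^ (1 / p₂) * A * (2 ^ n * lpOn p₁ φ (E n))) ^ p₂) ^ (1 / p₂) := by
        gcongr with n
        exact hpiece n
    _ = 4 * geomConst p₂ ^ (1 / p₂) * A * (∑' n, (2 ^ n * lpOn p₁ φ (E n)) ^ p₂) ^ (1 / p₂) := by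
        simp only [ENNReal.mul_rpow_of_nonneg (4 * geomConst p₂ ^ (1 / p₂) * A) _ hp₂.le]
        rw [ENNReal.tsum_mul_left, ENNReal.mul_rpow_of_nonneg _ _ (by positivity : 0 ≤ 1 / p₂),
          ← ENNReal.rpow_mul, mul_one_div_cancel hp₂.ne', ENNReal.rpow_one]
    _ ≤ 4 * geomConst p₂ ^ (1 / p₂) * A * (∑' n, (2 ^ n * lpOn p₁ φ (E n)) ^ q₁) ^ (1 / q₁) := by
        gcongr
        exact tsum_rpow_rpow_le _ hq₁ hqp
    _ ≤ 4 * geomConst p₂ ^ (1 / p₂) * A *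
          (geomConst q₁ * ∫⁻ t in Ioi 0, (lpOn p₁ φ (Ioi t) * u₁ t) ^ q₁) ^ (1 / q₁) := by
        gcongr
        exact tsum_levelSet_le hq₁ hu₁m hu₁ hp₁ φ
    _ = _ := by
        rw [ENNReal.mul_rpow_of_nonneg _ _ (by positivity), lpOn]
        ring

/-! ### From the embedding to the discrete inequality -/

theorem tsum_indicator_rpow {ι α : Type*} {B : ι → Set α} (hB : Pairwise (Function.onFun Disjoint B))
    (g : ι → α → ℝ≥0∞) {p : ℝ} (hp : 0 < p) (s : α) :
    (∑' k, (B k).indicator (g k) s) ^ p = ∑' k, (B k).indicator (fun s => g k s ^ p) s := by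
  by_cases h : ∃ k, s ∈ B k
  · obtain ⟨k, hk⟩ := h
    have hne : ∀ j ≠ k, s ∉ B j := fun j hj hjs => disjoint_left.1 (hB hj) hjs hk
    rw [tsum_eq_single k fun j hj => indicator_of_notMem (hne j hj) _,
      tsum_eq_single k fun j hj => indicator_of_notMem (hne j hj) _, indicator_of_mem hk,
      indicator_of_mem hk]
  · have hne : ∀ j, s ∉ B j := fun j hj => h ⟨j, hj⟩
    simp [hne, hp]

theorem DyadicMesh.disjoint_pred {r : ℝ} {ω : ℝ → ℝ≥0∞} {x : ℤ → ℝ} (hx : DyadicMesh r ω x) :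
    Pairwise (Function.onFun Disjoint fun k => Ioc (x (k - 1)) (x k)) :=
  hx.strictMono.monotone.pairwise_disjoint_on_Ioc_pred

/-- The mass of `ω ^ r` on the `k`-th block is comparable to that on `(0, x k)`. -/
theorem DyadicMesh.geomConst_mul_lintegral {r : ℝ} {ω : ℝ → ℝ≥0∞} {x : ℤ → ℝ}
    (hx : DyadicMesh r ω x) (hr0 : 0 < r) (k : ℤ) :
    ((2 : ℝ≥0∞) ^ k) ^ r = geomConst r * ∫⁻ s in Ioc (x (k - 1)) (x k), ω s ^ r := by
  have hint : ∀ j, ((2 : ℝ≥0∞) ^ j) ^ r = ∫⁻ s in Ioc 0 (x j), ω s ^ r := fun j => by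
    rw [← hx.lpOn_eq j, lpOn_rpow hr0, restrict_Ioo_eq_restrict_Ioc]
  refine eq_geomConst_mul_of_eq_add hr0
    (ENNReal.rpow_ne_top_of_nonneg hr0.le (two_zpow_ne_top k)) ?_
  have h2 := two_zpow_sub_nat_rpow k 1 r
  rw [pow_one, Nat.cast_one] at h2
  rw [mul_comm (2 ^ (-r)), ← h2, hint, hint, add_comm,
    ← lintegral_union measurableSet_Ioc (Ioc_disjoint_Ioc_of_le le_rfl),
    Ioc_union_Ioc_eq_Ioc (hx.pos _).le (hx.strictMono.monotone (by omega))]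

theorem DyadicMesh.lintegral_le {r : ℝ} {ω : ℝ → ℝ≥0∞} {x : ℤ → ℝ}
    (hx : DyadicMesh r ω x) (hr0 : 0 < r) (k : ℤ) :
    ∫⁻ s in Ioc (x (k - 1)) (x k), ω s ^ r ≤ ((2 : ℝ≥0∞) ^ k) ^ r := by
  rw [hx.geomConst_mul_lintegral hr0 k]
  exact le_mul_of_one_le_left' (one_le_geomConst r)

/-- The function `ω ^ (r / p)`, the extremal of Hölder's inequality, normalised on each block of the
mesh so that its `L^p` norm over the `k`-th block is comparable to `y k`. -/
noncomputable def blockExtremal (r p : ℝ) (ω : ℝ → ℝ≥0∞) (x : ℤ → ℝ) (y : ℤ → ℝ≥0∞) (s : ℝ) :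
    ℝ≥0∞ :=
  ∑' k, (Ioc (x (k - 1)) (x k)).indicator
    (fun s => y k * ((2 : ℝ≥0∞) ^ k) ^ (-(r / p)) * ω s ^ (r / p)) s

section blockExtremal

variable {r : ℝ} {ω : ℝ → ℝ≥0∞} {x : ℤ → ℝ} {p₁ p₂ q₁ q₂ : ℝ}

theorem aemeasurable_blockExtremal (hω : AEMeasurable ω (volume.restrict (Ioi 0)))
    (y : ℤ → ℝ≥0∞) : AEMeasurable (blockExtremal r p₁ ω x y) (volume.restrict (Ioi 0)) :=
  AEMeasurable.tsum fun _ => ((hω.pow_const _).const_mul _).indicator measurableSet_Ioc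

theorem DyadicMesh.lintegral_blockExtremal_le (hx : DyadicMesh r ω x) (hr0 : 0 < r) (hp₁ : 0 < p₁)
    (hω : AEMeasurable ω (volume.restrict (Ioi 0))) (y : ℤ → ℝ≥0∞) :
    ∫⁻ s in Ioi 0, blockExtremal r p₁ ω x y s ^ p₁ ≤ ∑' k, y k ^ p₁ := by
  simp only [blockExtremal, tsum_indicator_rpow hx.disjoint_pred _ hp₁]
  rw [lintegral_tsum fun k =>
    ((((hω.pow_const _).const_mul _).pow_const p₁).indicator measurableSet_Ioc)]
  refine ENNReal.tsum_le_tsum fun k => ?_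
  have hsub : Ioc (x (k - 1)) (x k) ⊆ Ioi 0 := fun s hs => (hx.pos (k - 1)).trans hs.1
  rw [lintegral_indicator measurableSet_Ioc, Measure.restrict_restrict measurableSet_Ioc,
    inter_eq_left.2 hsub]
  have e : ∀ s, (y k * ((2 : ℝ≥0∞) ^ k) ^ (-(r / p₁)) * ω s ^ (r / p₁)) ^ p₁ =
      y k ^ p₁ * ((2 : ℝ≥0∞) ^ k) ^ (-r) * ω s ^ r := fun s => by
    rw [ENNReal.mul_rpow_of_nonneg _ _ hp₁.le, ENNReal.mul_rpow_of_nonneg _ _ hp₁.le,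
      ← ENNReal.rpow_mul, ← ENNReal.rpow_mul, neg_mul, div_mul_cancel₀ _ hp₁.ne']
  simp only [e]
  rw [lintegral_const_mul'' _ ((hω.mono_measure (Measure.restrict_mono hsub le_rfl)).pow_const r)]
  calc _ ≤ y k ^ p₁ * ((2 : ℝ≥0∞) ^ k) ^ (-r) * ((2 : ℝ≥0∞) ^ k) ^ r := by
        gcongr
        exact hx.lintegral_le hr0 k
    _ = y k ^ p₁ := by
        rw [mul_assoc, ← ENNReal.rpow_add _ _ (two_zpow_pos k).ne' (two_zpow_ne_top k),
          neg_add_cancel, ENNReal.rpow_zero, mul_one]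

theorem DyadicMesh.copson_blockExtremal_le (hx : DyadicMesh r ω x) (hr0 : 0 < r) (hp₁ : 0 < p₁)
    (hω : AEMeasurable ω (volume.restrict (Ioi 0))) (hq₁ : 0 < q₁) {u₁ : ℝ → ℝ≥0∞}
    (hu₁ : AEMeasurable u₁ (volume.restrict (Ioi 0))) (K : ℤ) {y : ℤ → ℝ≥0∞}
    (hy : ∀ k, K < k → y k = 0) :
    lpOn q₁ (fun t => lpOn p₁ (blockExtremal r p₁ ω x y) (Ioi t) * u₁ t) (Ioi 0) ≤
      lpOn q₁ u₁ (Ioo 0 (x K)) * (∑' k, y k ^ p₁) ^ (1 / p₁) := by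
  have hzero : ∀ s, x K < s → blockExtremal r p₁ ω x y s = 0 := fun s hs => by
    refine ENNReal.tsum_eq_zero.2 fun k => ?_
    rw [indicator_apply_eq_zero]
    intro hsk
    have : K < k := hx.strictMono.lt_iff_lt.1 (hs.trans_le hsk.2)
    simp [hy k this]
  have hpt : ∀ t ∈ Ioi (0 : ℝ), (lpOn p₁ (blockExtremal r p₁ ω x y) (Ioi t) * u₁ t) ^ q₁ ≤
      (Ioo 0 (x K)).indicator (fun t => ((∑' k, y k ^ p₁) ^ (1 / p₁)) ^ q₁ * u₁ t ^ q₁) t := by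
    intro t ht
    by_cases htK : t < x K
    · rw [indicator_of_mem (show t ∈ Ioo 0 (x K) from ⟨ht, htK⟩),
        ENNReal.mul_rpow_of_nonneg _ _ hq₁.le]
      gcongr
      refine (lpOn_mono hp₁ _ (Ioi_subset_Ioi (le_of_lt ht))).trans ?_
      rw [lpOn]
      gcongr
      exact hx.lintegral_blockExtremal_le hr0 hp₁ hω y
    · have h0 : lpOn p₁ (blockExtremal r p₁ ω x y) (Ioi t) = 0 := by
        rw [lpOn, setLIntegral_congr_fun (g := fun _ => 0) measurableSet_Ioi fun s hs => ?_]
        · simp [hp₁]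
        · simp [hzero s (lt_of_le_of_lt (not_lt.1 htK) hs), hp₁]
      simp [h0, hq₁]
  rw [lpOn]
  calc _ ≤ (∫⁻ t in Ioi 0, (Ioo 0 (x K)).indicator
            (fun t => ((∑' k, y k ^ p₁) ^ (1 / p₁)) ^ q₁ * u₁ t ^ q₁) t) ^ (1 / q₁) := by
        gcongr ?_ ^ _
        exact setLIntegral_mono' measurableSet_Ioi hpt
    _ = _ := by
        rw [lintegral_indicator measurableSet_Ioo, Measure.restrict_restrict measurableSet_Ioo,
          inter_eq_left.2 Ioo_subset_Ioi_self, lintegral_const_mul'' _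
          ((hu₁.mono_measure (Measure.restrict_mono Ioo_subset_Ioi_self le_rfl)).pow_const q₁),
          ENNReal.mul_rpow_of_nonneg _ _ (by positivity), ← ENNReal.rpow_mul (_ ^ (1 / p₁)),
          mul_one_div_cancel hq₁.ne', ENNReal.rpow_one, mul_comm, lpOn]

theorem DyadicMesh.le_cesaro_blockExtremal (hx : DyadicMesh r ω x) (hr0 : 0 < r) (hp₁ : 0 < p₁)
    (hp₂ : 0 < p₂) (hr : 1 / p₂ = 1 / p₁ + 1 / r) (hpq : p₂ < q₂)
    (hω : AEMeasurable ω (volume.restrict (Ioi 0))) {u₂ : ℝ → ℝ≥0∞}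
    (hu₂ : AEMeasurable u₂ (volume.restrict (Ioi 0))) (y : ℤ → ℝ≥0∞) :
    (∑' k, (2 ^ k * lpOn q₂ u₂ (Ioi (x k)) * y k) ^ q₂) ^ (1 / q₂) ≤
      geomConst r ^ (1 / p₂) *
        lpOn q₂ (fun t => lpOn p₂ (fun s => blockExtremal r p₁ ω x y s * ω s) (Ioo 0 t) * u₂ t)
          (Ioi 0) := by
  have hq₂ : 0 < q₂ := hp₂.trans hpq
  have hrp : (r / p₁ + 1) * p₂ = r := by
    field_simp at hr ⊢
    linarith
  have hblock : ∀ k, (2 ^ k * y k) ^ p₂ = geomConst r * ∫⁻ s in Ioc (x (k - 1)) (x k),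
      (y k * ((2 : ℝ≥0∞) ^ k) ^ (-(r / p₁)) * ω s ^ (r / p₁) * ω s) ^ p₂ := by
    intro k
    have hsub : Ioc (x (k - 1)) (x k) ⊆ Ioi 0 := fun s hs => (hx.pos (k - 1)).trans hs.1
    have e : ∀ s, (y k * ((2 : ℝ≥0∞) ^ k) ^ (-(r / p₁)) * ω s ^ (r / p₁) * ω s) ^ p₂ =
        y k ^ p₂ * ((2 : ℝ≥0∞) ^ k) ^ (-(r / p₁) * p₂) * ω s ^ r := fun s => by
      have : ω s ^ (r / p₁) * ω s = ω s ^ (r / p₁ + 1) := by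
        rw [ENNReal.rpow_add_of_nonneg _ _ (by positivity) zero_le_one, ENNReal.rpow_one]
      rw [mul_assoc, this, ENNReal.mul_rpow_of_nonneg _ _ hp₂.le,
        ENNReal.mul_rpow_of_nonneg _ _ hp₂.le, ← ENNReal.rpow_mul, ← ENNReal.rpow_mul, hrp]
    simp only [e]
    rw [lintegral_const_mul'' _
      ((hω.mono_measure (Measure.restrict_mono hsub le_rfl)).pow_const r), mul_left_comm,
      ← hx.geomConst_mul_lintegral hr0, mul_assoc,
      ← ENNReal.rpow_add _ _ (two_zpow_pos k).ne' (two_zpow_ne_top k),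
      ENNReal.mul_rpow_of_nonneg _ _ hp₂.le, mul_comm]
    congr 2
    linarith
  have hinner : ∀ t, ∑' k, (Ioi (x k)).indicator (fun _ => (2 ^ k * y k) ^ q₂) t ≤
      geomConst r ^ (q₂ / p₂) *
        lpOn p₂ (fun s => blockExtremal r p₁ ω x y s * ω s) (Ioo 0 t) ^ q₂ := by
    intro t
    have h1 : ∑' k, (Ioi (x k)).indicator (fun _ => (2 ^ k * y k) ^ p₂) t ≤
        geomConst r * lpOn p₂ (fun s => blockExtremal r p₁ ω x y s * ω s) (Ioo 0 t) ^ p₂ := by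
      have e : ∀ s, (blockExtremal r p₁ ω x y s * ω s) ^ p₂ =
          ∑' k, (Ioc (x (k - 1)) (x k)).indicator
            (fun s => (y k * ((2 : ℝ≥0∞) ^ k) ^ (-(r / p₁)) * ω s ^ (r / p₁) * ω s) ^ p₂) s :=
          fun s => by
        rw [blockExtremal, ← ENNReal.tsum_mul_right, ← tsum_indicator_rpow hx.disjoint_pred _ hp₂]
        congr 1
        refine tsum_congr fun k => ?_
        simp only [indicator]
        split_ifs <;> simp
      rw [lpOn_rpow hp₂]
      simp only [e]
      have hm : ∀ k, AEMeasurable ((Ioc (x (k - 1)) (x k)).indicator fun s =>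
          (y k * ((2 : ℝ≥0∞) ^ k) ^ (-(r / p₁)) * ω s ^ (r / p₁) * ω s) ^ p₂)
          (volume.restrict (Ioo 0 t)) := fun k =>
        (((((hω.pow_const _).const_mul _).mul hω).pow_const p₂).indicator
          measurableSet_Ioc).mono_measure (Measure.restrict_mono Ioo_subset_Ioi_self le_rfl)
      rw [lintegral_tsum hm, ← ENNReal.tsum_mul_left]
      refine ENNReal.tsum_le_tsum fun k => ?_
      refine indicator_apply_le' (fun hk => ?_) (fun _ => zero_le)
      rw [hblock k, lintegral_indicator measurableSet_Ioc,
        Measure.restrict_restrict measurableSet_Ioc, inter_eq_left.2]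
      exact fun s hs => ⟨(hx.pos _).trans hs.1, hs.2.trans_lt hk⟩
    have h2 := ENNReal.rpow_le_rpow h1 (z := q₂ / p₂) (by positivity)
    rw [ENNReal.mul_rpow_of_nonneg _ _ (by positivity), ← ENNReal.rpow_mul (lpOn _ _ _),
      mul_div_cancel₀ q₂ hp₂.ne'] at h2
    refine le_trans ?_ h2
    refine le_trans (le_of_eq ?_) (tsum_rpow_le_rpow_tsum _ ((one_le_div hp₂).2 hpq.le))
    refine tsum_congr fun k => ?_
    simp only [indicator]
    have : 0 < q₂ / p₂ := by positivity
    split_ifs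
    · rw [← ENNReal.rpow_mul, mul_div_cancel₀ q₂ hp₂.ne']
    · simp [this]
  have hmain : ∑' k, (2 ^ k * lpOn q₂ u₂ (Ioi (x k)) * y k) ^ q₂ ≤ geomConst r ^ (q₂ / p₂) *
      ∫⁻ t in Ioi 0,
        (lpOn p₂ (fun s => blockExtremal r p₁ ω x y s * ω s) (Ioo 0 t) * u₂ t) ^ q₂ := by
    calc _ = ∑' k, ∫⁻ t in Ioi 0, (Ioi (x k)).indicator (fun _ => (2 ^ k * y k) ^ q₂) t *
              u₂ t ^ q₂ := by
          exact tsum_congr fun k => (lintegral_indicator_Ioi_mul hq₂ hu₂ (hx.pos k).le _ _).symm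
      _ = ∫⁻ t in Ioi 0, (∑' k, (Ioi (x k)).indicator (fun _ => (2 ^ k * y k) ^ q₂) t) *
              u₂ t ^ q₂ := by
          have hm : ∀ k, AEMeasurable (fun t => (Ioi (x k)).indicator
              (fun _ => (2 ^ k * y k) ^ q₂) t * u₂ t ^ q₂) (volume.restrict (Ioi 0)) := fun k =>
            ((measurable_const.indicator measurableSet_Ioi).aemeasurable).mul (hu₂.pow_const q₂)
          rw [← lintegral_tsum hm]
          simp only [ENNReal.tsum_mul_right]
      _ ≤ ∫⁻ t in Ioi 0, geomConst r ^ (q₂ / p₂) *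
            (lpOn p₂ (fun s => blockExtremal r p₁ ω x y s * ω s) (Ioo 0 t) * u₂ t) ^ q₂ := by
          refine lintegral_mono fun t => ?_
          dsimp only
          rw [ENNReal.mul_rpow_of_nonneg _ _ hq₂.le, ← mul_assoc]
          gcongr
          exact hinner t
      _ = _ := lintegral_const_mul'' _
          (((monotone_lpOn_Ioo hp₂ _).measurable.aemeasurable.mul hu₂).pow_const q₂)
  have h3 := ENNReal.rpow_le_rpow hmain (z := 1 / q₂) (by positivity)
  rw [ENNReal.mul_rpow_of_nonneg _ _ (by positivity), ← ENNReal.rpow_mul] at h3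
  rw [show q₂ / p₂ * (1 / q₂) = 1 / p₂ by field_simp] at h3
  exact h3

/-- If the Cesàro functional is dominated by the Copson functional, then the discrete inequality
holds. -/
theorem DyadicMesh.discrete_of_cesaro_le_copson (hx : DyadicMesh r ω x) (hp₂ : 0 < p₂)
    (hp₁ : 0 < p₁) (hr0 : 0 < r) (hr : 1 / p₂ = 1 / p₁ + 1 / r) (hq₁ : 0 < q₁) (hpq : p₂ < q₂)
    (hω : AEMeasurable ω (volume.restrict (Ioi 0)))
    {u₁ : ℝ → ℝ≥0∞} (hu₁m : AEMeasurable u₁ (volume.restrict (Ioi 0)))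
    (hu₁ : ∀ t, 0 < t → 0 < lpOn q₁ u₁ (Ioo 0 t) ∧ lpOn q₁ u₁ (Ioo 0 t) < ∞)
    {u₂ : ℝ → ℝ≥0∞} (hu₂ : AEMeasurable u₂ (volume.restrict (Ioi 0))) {c : ℝ≥0∞}
    (hc : ∀ φ : ℝ → ℝ≥0∞, AEMeasurable φ (volume.restrict (Ioi 0)) →
      lpOn q₁ (fun t => lpOn p₁ φ (Ioi t) * u₁ t) (Ioi 0) < ∞ →
      lpOn q₂ (fun t => lpOn p₂ (fun s => φ s * ω s) (Ioo 0 t) * u₂ t) (Ioi 0) ≤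
        c * lpOn q₁ (fun t => lpOn p₁ φ (Ioi t) * u₁ t) (Ioi 0))
    (K : ℤ) {y : ℤ → ℝ≥0∞} (hy : ∀ k, K < k → y k = 0) (hy' : ∑' k, y k ^ p₁ ≠ ∞) :
    (∑' k, (2 ^ k * lpOn q₂ u₂ (Ioi (x k)) * y k) ^ q₂) ^ (1 / q₂) ≤
      geomConst r ^ (1 / p₂) * c * lpOn q₁ u₁ (Ioo 0 (x K)) * (∑' k, y k ^ p₁) ^ (1 / p₁) := by
  have hcop := hx.copson_blockExtremal_le hr0 hp₁ hω hq₁ hu₁m K hy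
  refine (hx.le_cesaro_blockExtremal hr0 hp₁ hp₂ hr hpq hω hu₂ y).trans ?_
  have hfin : lpOn q₁ u₁ (Ioo 0 (x K)) * (∑' k, y k ^ p₁) ^ (1 / p₁) < ∞ :=
    ENNReal.mul_lt_top (hu₁ _ (hx.pos K)).2
      (ENNReal.rpow_lt_top_of_nonneg (by positivity) hy')
  have h := hc _ (aemeasurable_blockExtremal (p₁ := p₁) (r := r) (x := x) hω y)
    (hcop.trans_lt hfin)
  calc _ ≤ geomConst r ^ (1 / p₂) *
        (c * (lpOn q₁ u₁ (Ioo 0 (x K)) * (∑' k, y k ^ p₁) ^ (1 / p₁))) := by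
        gcongr
        exact h.trans (by gcongr)
    _ = _ := by ring

end blockExtremal

/-! ### Multipliers between sequence spaces -/

theorem tsum_Iic_le_tsum (b : ℤ → ℝ≥0∞) (K : ℤ) : ∑' k : Iic K, b k ≤ ∑' k, b k :=
  ENNReal.tsum_comp_le_tsum_of_injective Subtype.val_injective b

theorem discrete_of_forall_le {p q : ℝ} (hp : 0 < p) (hpq : p ≤ q) (τ : ℤ → ℝ≥0∞) (K : ℤ)
    {D : ℝ≥0∞} (hD : ∀ k ≤ K, τ k ≤ D) (y : ℤ → ℝ≥0∞) :
    (∑' k : Iic K, (τ k * y k) ^ q) ^ (1 / q) ≤ D * (∑' k, y k ^ p) ^ (1 / p) := by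
  have hq : 0 < q := hp.trans_le hpq
  calc _ ≤ (∑' k : Iic K, (D * y k) ^ q) ^ (1 / q) := by
        gcongr with k
        exact hD k k.2
    _ = D * (∑' k : Iic K, y k ^ q) ^ (1 / q) := by
        simp only [ENNReal.mul_rpow_of_nonneg D _ hq.le]
        rw [ENNReal.tsum_mul_left, ENNReal.mul_rpow_of_nonneg _ _ (by positivity),
          ← ENNReal.rpow_mul, mul_one_div_cancel hq.ne', ENNReal.rpow_one]
    _ ≤ D * (∑' k, y k ^ q) ^ (1 / q) := by
        gcongr
        exact tsum_Iic_le_tsum (fun k => y k ^ q) K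
    _ ≤ _ := by
        gcongr
        exact tsum_rpow_rpow_le _ hp hpq

theorem discrete_of_tsum_le {p q ρ : ℝ} (hq : 0 < q) (hqp : q < p)
    (hρ : 1 / q = 1 / p + 1 / ρ) (τ : ℤ → ℝ≥0∞) (K : ℤ)
    {D : ℝ≥0∞} (hD : (∑' k : Iic K, τ k ^ ρ) ^ (1 / ρ) ≤ D) (y : ℤ → ℝ≥0∞) :
    (∑' k : Iic K, (τ k * y k) ^ q) ^ (1 / q) ≤ D * (∑' k, y k ^ p) ^ (1 / p) := by
  have hp : 0 < p := hq.trans hqp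
  refine (tsum_mul_rpow_le hq hqp hρ (fun k : Iic K => y k) (fun k => τ k)).trans ?_
  gcongr
  exact tsum_Iic_le_tsum (fun k => y k ^ p) K

/-- The discrete inequality tested on a unit vector. -/
theorem le_of_discrete {p q : ℝ} (hp : 0 < p) (hq : 0 < q) (τ : ℤ → ℝ≥0∞) (K : ℤ) {D : ℝ≥0∞}
    (hD : ∀ y : ℤ → ℝ≥0∞, (∀ k, K < k → y k = 0) → ∑' k, y k ^ p ≠ ∞ →
      (∑' k, (τ k * y k) ^ q) ^ (1 / q) ≤ D * (∑' k, y k ^ p) ^ (1 / p)) : τ K ≤ D := by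
  have e1 : ∑' k, (Pi.single K 1 : ℤ → ℝ≥0∞) k ^ p = 1 := by
    rw [tsum_eq_single K fun j hj => by simp [Pi.single_eq_of_ne hj, hp]]
    simp
  have e2 : ∑' k, (τ k * (Pi.single K 1 : ℤ → ℝ≥0∞) k) ^ q = τ K ^ q := by
    rw [tsum_eq_single K fun j hj => by simp [Pi.single_eq_of_ne hj, hq]]
    simp
  have h := hD (Pi.single K 1) (fun k hk => Pi.single_eq_of_ne hk.ne' _) (by simp [e1])
  rwa [e1, e2, ← ENNReal.rpow_mul, mul_one_div_cancel hq.ne', ENNReal.rpow_one, ENNReal.one_rpow,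
    mul_one] at h

/-- The converse of Hölder's inequality: the `ℓ^ρ` norm of a multiplier is at most its norm as an
operator from `ℓ^p` to `ℓ^q`, tested on finitely supported sequences. -/
theorem tsum_le_of_discrete {p q ρ : ℝ} (hp : 0 < p) (hq : 0 < q) (hρ0 : 0 < ρ)
    (hρ : 1 / q = 1 / p + 1 / ρ) (τ : ℤ → ℝ≥0∞) (hτ : ∀ k, τ k ≠ ∞) (K : ℤ) {D : ℝ≥0∞}
    (hD : ∀ y : ℤ → ℝ≥0∞, (∀ k, K < k → y k = 0) → ∑' k, y k ^ p ≠ ∞ →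
      (∑' k, (τ k * y k) ^ q) ^ (1 / q) ≤ D * (∑' k, y k ^ p) ^ (1 / p)) :
    (∑' k : Iic K, τ k ^ ρ) ^ (1 / ρ) ≤ D := by
  rw [one_div, ENNReal.rpow_inv_le_iff hρ0, ENNReal.tsum_eq_iSup_sum]
  refine iSup_le fun F => ?_
  rw [← ENNReal.rpow_inv_le_iff hρ0, ← one_div]
  set G : Finset ℤ := F.map (Function.Embedding.subtype _) with hG
  have hGK : ∀ k ∈ G, k ≤ K := by
    intro k hk
    simp only [hG, Finset.mem_map, Function.Embedding.subtype_apply] at hk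
    obtain ⟨j, -, rfl⟩ := hk
    exact j.2
  have hsum : ∑ k ∈ F, τ k ^ ρ = ∑ k ∈ G, τ k ^ ρ := by
    rw [hG, Finset.sum_map]
    rfl
  rw [hsum]
  set e := ∑ k ∈ G, τ k ^ ρ with he
  have het : e ≠ ∞ := ENNReal.sum_ne_top.2 fun k _ =>
    ENNReal.rpow_ne_top_of_nonneg hρ0.le (hτ k)
  rcases eq_or_ne e 0 with h0 | h0
  · rw [h0, ENNReal.zero_rpow_of_pos (by positivity)]
    exact zero_le
  -- the sequence for which Hölder's inequality with the multiplier `τ` is an equality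
  set y : ℤ → ℝ≥0∞ := (G : Set ℤ).indicator fun k => τ k ^ (ρ / p) with hy
  have e1 : ∑' k, y k ^ p = e := by
    rw [tsum_eq_sum (s := G) fun k hk => by simp [hy, hk, hp], he]
    refine Finset.sum_congr rfl fun k hk => ?_
    rw [hy, indicator_of_mem (Finset.mem_coe.2 hk), ← ENNReal.rpow_mul, div_mul_cancel₀ _ hp.ne']
  have hexp : (1 + ρ / p) * q = ρ := by
    field_simp at hρ ⊢
    linarith
  have e2 : ∑' k, (τ k * y k) ^ q = e := by
    rw [tsum_eq_sum (s := G) fun k hk => by simp [hy, hk, hq], he]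
    refine Finset.sum_congr rfl fun k hk => ?_
    rw [hy, indicator_of_mem (Finset.mem_coe.2 hk)]
    have : τ k * τ k ^ (ρ / p) = τ k ^ (1 + ρ / p) := by
      rw [ENNReal.rpow_add_of_nonneg _ _ zero_le_one (by positivity), ENNReal.rpow_one]
    rw [this, ← ENNReal.rpow_mul, hexp]
  have h := hD y (fun k hk => indicator_of_notMem
    (fun hkG => absurd (hGK k (Finset.mem_coe.1 hkG)) (not_le.2 hk)) _) (by rwa [e1])
  rw [e1, e2] at h
  calc e ^ (1 / ρ) = e ^ (1 / q) * e ^ (-(1 / p)) := by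
        rw [← ENNReal.rpow_add _ _ h0 het]
        congr 1
        linarith
    _ ≤ D * e ^ (1 / p) * e ^ (-(1 / p)) := by gcongr
    _ = D := by
        rw [mul_assoc, ← ENNReal.rpow_add _ _ h0 het, add_neg_cancel, ENNReal.rpow_zero, mul_one]

/-! ### The Lebesgue–Stieltjes measure of the tail norms -/

theorem tendsto_setLIntegral_Ioi_nhdsGT (g : ℝ → ℝ≥0∞) (a : ℝ) :
    Tendsto (fun t => ∫⁻ x in Ioi t, g x) (𝓝[>] a) (𝓝 (∫⁻ x in Ioi a, g x)) := by
  have hmono : ∀ {s t : ℝ}, s ≤ t → ∫⁻ x in Ioi t, g x ≤ ∫⁻ x in Ioi s, g x := fun h =>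
    lintegral_mono_set (Ioi_subset_Ioi h)
  obtain ⟨v, hv, hva, hvt⟩ := exists_seq_strictAnti_tendsto a
  have hU : ⋃ n, Ioi (v n) = Ioi a := by
    ext s
    simp only [mem_iUnion, mem_Ioi]
    refine ⟨fun ⟨n, hn⟩ => (hva n).trans hn, fun hs => ?_⟩
    exact (hvt.eventually_lt_const hs).exists
  have hsup : ∫⁻ x in Ioi a, g x = ⨆ n, ∫⁻ x in Ioi (v n), g x := by
    rw [← hU]
    refine setLIntegral_iUnion_of_directed g (Monotone.directed_le fun m n hmn => ?_)
    exact Ioi_subset_Ioi (hv.antitone hmn)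
  refine tendsto_order.2 ⟨fun b hb => ?_, fun b hb => ?_⟩
  · rw [hsup] at hb
    obtain ⟨n, hn⟩ := lt_iSup_iff.1 hb
    filter_upwards [Ioo_mem_nhdsGT (hva n)] with t ht
    exact hn.trans_le (hmono ht.2.le)
  · filter_upwards [self_mem_nhdsWithin] with t ht
    exact (hmono (le_of_lt ht)).trans_lt hb

theorem tendsto_setLIntegral_Ioi_atTop {g : ℝ → ℝ≥0∞} {a : ℝ} (ha : ∫⁻ x in Ioi a, g x ≠ ∞) :
    Tendsto (fun t => ∫⁻ x in Ioi t, g x) atTop (𝓝 0) := by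
  set ν : Measure ℝ := volume.withDensity g with hν
  have hval : ∀ t, ∫⁻ x in Ioi t, g x = ν (Ioi t) := fun t =>
    (withDensity_apply g measurableSet_Ioi).symm
  have h := tendsto_measure_iInter_atTop (μ := ν) (s := fun t : ℝ => Ioi t)
    (fun t => measurableSet_Ioi.nullMeasurableSet) (fun s t hst => Ioi_subset_Ioi hst)
    ⟨a, by rwa [← hval]⟩
  have hempty : ⋂ t : ℝ, Ioi t = ∅ := by
    ext s
    simp only [mem_iInter, mem_Ioi, mem_empty_iff_false, iff_false, not_forall]
    exact ⟨s, lt_irrefl s⟩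
  rw [hempty, measure_empty] at h
  simp only [hval]
  exact h

/-- The right limit in the definition of the Stieltjes measure is harmless where `F` is continuous
from the right. -/
theorem stieltjesMeasure_Ioi {F : ℝ → ℝ} (hF : MonotoneOn F (Ioi 0)) {a : ℝ} (ha : 0 < a)
    (hcont : Tendsto F (𝓝[>] a) (𝓝 (F a))) {l : ℝ} (hl : Tendsto F atTop (𝓝 l)) :
    stieltjesMeasure F hF (Ioi a) = ENNReal.ofReal (l - F a) := by
  set G : Ioi (0 : ℝ) → ℝ := fun t => F t with hG
  have hGm : Monotone G := monotone_subtype hF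
  have hGl : Tendsto G atTop (𝓝 l) := tendsto_comp_val_Ioi_atTop.2 hl
  have hlim : Tendsto hGm.stieltjesFunction atTop (𝓝 l) := by
    -- the right limit at `t` lies between the values at `t` and at `2 * t`
    have hdbl : Tendsto (fun t : Ioi (0 : ℝ) => F (2 * t)) atTop (𝓝 l) :=
      (tendsto_comp_val_Ioi_atTop (f := fun t => F (2 * t))).2
        (hl.comp (tendsto_id.const_mul_atTop (by norm_num : (0 : ℝ) < 2)))
    refine tendsto_of_tendsto_of_tendsto_of_le_of_le hGl hdbl (fun t => hGm.le_rightLim le_rfl)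
      fun t => ?_
    have ht : (0 : ℝ) < t := t.2
    have h2 : (0 : ℝ) < 2 * t := by linarith
    exact hGm.rightLim_le (show t < (⟨2 * t, h2⟩ : Ioi (0 : ℝ)) from
      Subtype.mk_lt_mk.2 (by linarith))
  have hright : hGm.stieltjesFunction ⟨a, ha⟩ = F a := by
    rw [Monotone.stieltjesFunction_eq]
    refine (hGm.continuousWithinAt_Ioi_iff_rightLim_eq).1 ?_
    refine hcont.comp ?_
    exact continuous_subtype_val.continuousWithinAt.tendsto_nhdsWithin fun t ht => ht
  have hpre : (Subtype.val : Ioi (0 : ℝ) → ℝ) ⁻¹' Ioi a = Ioi ⟨a, ha⟩ := rfl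
  rw [stieltjesMeasure, Measure.map_apply measurable_subtype_coe measurableSet_Ioi, hpre,
    StieltjesFunction.measure_Ioi _ hlim, hright]

theorem stieltjesMeasure_ae_pos {F : ℝ → ℝ} (hF : MonotoneOn F (Ioi 0)) :
    ∀ᵐ t ∂(stieltjesMeasure F hF), 0 < t := by
  rw [stieltjesMeasure, ae_map_iff measurable_subtype_coe.aemeasurable measurableSet_Ioi]
  exact Eventually.of_forall fun t => t.2

theorem tailMeasure_Ioi {q : ℝ≥0∞} (hq : 0 < q ∧ q < ∞) {u : ℝ → ℝ≥0∞} (hu : u ∈ Omega q)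
    {s : ℝ≥0∞} (hs : 0 < s.toReal) {a : ℝ} (ha : 0 < a) :
    tailMeasure hu s (Ioi a) = lpOn q.toReal u (Ioi a) ^ s.toReal := by
  have hq0 : 0 < q.toReal := ENNReal.toReal_pos hq.1.ne' hq.2.ne
  have hfin : ∀ t, 0 < t → lpOn q.toReal u (Ioi t) ≠ ∞ := fun t ht => by
    rw [← normOn_eq_lpOn hq]
    exact (hu.2 t ht).2.ne
  have hcontpow : Continuous fun z : ℝ≥0∞ => (z ^ (1 / q.toReal)) ^ s.toReal :=
    (ENNReal.continuous_rpow_const).comp ENNReal.continuous_rpow_const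
  have h1 : Tendsto (fun t => lpOn q.toReal u (Ioi t) ^ s.toReal) (𝓝[>] a)
      (𝓝 (lpOn q.toReal u (Ioi a) ^ s.toReal)) :=
    (hcontpow.tendsto _).comp (tendsto_setLIntegral_Ioi_nhdsGT (fun x => u x ^ q.toReal) a)
  have h2 : Tendsto (fun t => lpOn q.toReal u (Ioi t) ^ s.toReal) atTop (𝓝 0) := by
    have h := (hcontpow.tendsto 0).comp
      (tendsto_setLIntegral_Ioi_atTop (g := fun x => u x ^ q.toReal) (a := a) (by
        rw [← lpOn_rpow hq0]
        exact ENNReal.rpow_ne_top_of_nonneg hq0.le (hfin a ha)))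
    rw [ENNReal.zero_rpow_of_pos (by positivity), ENNReal.zero_rpow_of_pos hs] at h
    exact h
  have hpowfin : lpOn q.toReal u (Ioi a) ^ s.toReal ≠ ∞ :=
    ENNReal.rpow_ne_top_of_nonneg hs.le (hfin a ha)
  rw [tailMeasure, stieltjesMeasure_Ioi (l := 0) _ ha]
  · rw [zero_sub, neg_neg, normOn_eq_lpOn hq, ENNReal.ofReal_toReal hpowfin]
  · simp only [normOn_eq_lpOn hq]
    exact ((ENNReal.tendsto_toReal hpowfin).comp h1).neg
  · simp only [normOn_eq_lpOn hq]
    simpa using ((ENNReal.tendsto_toReal ENNReal.zero_ne_top).comp h2).neg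

/-! ### The exponents and the mesh -/

theorem arrow_spec {p q : ℝ≥0∞} (hq : 0 < q ∧ q < ∞) (h : q < p) :
    (0 < arrow p q ∧ arrow p q < ∞) ∧
      1 / q.toReal = 1 / p.toReal + 1 / (arrow p q).toReal := by
  have hlt : p⁻¹ < q⁻¹ := ENNReal.inv_lt_inv.2 h
  have hqt : q⁻¹ ≠ ∞ := ENNReal.inv_ne_top.2 hq.1.ne'
  have hsub : q⁻¹ - p⁻¹ ≠ ∞ := ENNReal.sub_ne_top hqt
  rw [arrow, if_pos h]
  refine ⟨⟨ENNReal.inv_pos.2 hsub, ENNReal.inv_lt_top.2 (tsub_pos_of_lt hlt)⟩, ?_⟩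
  rw [ENNReal.toReal_inv, ENNReal.toReal_sub_of_le hlt.le hqt, ENNReal.toReal_inv,
    ENNReal.toReal_inv]
  simp

theorem exists_dyadicMesh {r : ℝ} (hr : 0 < r) {ω : ℝ → ℝ≥0∞}
    (hω : AEMeasurable ω (volume.restrict (Ioi 0)))
    (hadm : Admissible fun t => lpOn r ω (Ioo 0 t)) : ∃ x, DyadicMesh r ω x := by
  have hex : ∀ k : ℤ, ∃ t, 0 < t ∧ lpOn r ω (Ioo 0 t) = 2 ^ k := fun k => by
    have h1 := hadm.tendsto.eventually_const_lt (two_zpow_ne_top k).lt_top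
    obtain ⟨s, hs, hs0⟩ := (h1.and (eventually_gt_atTop 0)).exists
    obtain ⟨t, ht0, -, ht⟩ := exists_lpOn_Ioo_eq hr hω hs0 (hadm.finite s hs0.le).ne
      (two_zpow_pos k) hs.le
    exact ⟨t, ht0, ht⟩
  choose x hx0 hx using hex
  have hrefl : ∀ {s t : ℝ}, lpOn r ω (Ioo 0 s) < lpOn r ω (Ioo 0 t) → s < t := fun h =>
    (monotone_lpOn_Ioo hr ω).reflect_lt h
  refine ⟨x, strictMono_int_of_lt_succ fun k => hrefl ?_, hx0, fun t ht => ?_, hx⟩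
  · rw [hx, hx, two_zpow_add_one, two_mul]
    exact ENNReal.lt_add_right (two_zpow_ne_top k) (two_zpow_pos k).ne'
  · have hpos : 0 < lpOn r ω (Ioo 0 t) := by
      have := hadm.strictMonoOn (self_mem_Ici (a := (0 : ℝ))) (le_of_lt ht : (0 : ℝ) ≤ t) ht
      exact (zero_le).trans_lt this
    obtain ⟨k, hk⟩ := ENNReal.exists_mem_Ioc_zpow hpos.ne' (hadm.finite t ht.le).ne
      (y := 2) (by norm_num) (by norm_num)
    refine ⟨k, hrefl (by rw [hx]; exact hk.1), not_lt.1 fun hlt => ?_⟩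
    have h := hadm.strictMonoOn (le_of_lt (hx0 (k + 1)) : (0 : ℝ) ≤ _) (le_of_lt ht : (0 : ℝ) ≤ t) hlt
    rw [hx] at h
    exact absurd hk.2 (not_le.2 h)

/-! ### The kernel and the discretised right-hand sides -/

/-- The bound `V(s) 𝒱(x,s) 𝒱(t,x) ≤ min (V(s)) (V(t))`, uniform in `x`. -/
theorem mul_div_mul_div_le_min (a b c : ℝ≥0∞) :
    a * (c / (c + a)) * (b / (b + c)) ≤ min a b := by
  have hdiv : ∀ y z : ℝ≥0∞, y / (y + z) ≤ 1 := fun y z =>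
    ENNReal.div_le_of_le_mul (by rw [one_mul]; exact le_self_add)
  have hswap : ∀ y z : ℝ≥0∞, y * (z / (z + y)) ≤ z := fun y z => by
    calc y * (z / (z + y)) = z * (y / (y + z)) := by
          rw [div_eq_mul_inv, div_eq_mul_inv, add_comm z y]
          ring
      _ ≤ z * 1 := by gcongr; exact hdiv y z
      _ = z := mul_one z
  refine le_min ?_ ?_
  · calc _ ≤ a * 1 * 1 := by gcongr <;> exact hdiv _ _
      _ = a := by ring
  · calc _ ≤ c * (b / (b + c)) := by gcongr; exact hswap a c
      _ ≤ b := hswap c b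

theorem min_le_mul_div {b c : ℝ≥0∞} (hb : b ≠ 0) (hb' : b ≠ ∞) (hc : c ≠ ∞) :
    min b c ≤ 2 * c * (b / (b + c)) := by
  have hsum : b + c ≠ ∞ := ENNReal.add_ne_top.2 ⟨hb', hc⟩
  have hsum0 : b + c ≠ 0 := fun h => hb (add_eq_zero.1 h).1
  rw [← mul_div_assoc, ENNReal.le_div_iff_mul_le (Or.inl hsum0) (Or.inl hsum)]
  calc min b c * (b + c) ≤ min b c * (2 * max b c) := by
        gcongr
        rw [two_mul]
        exact add_le_add (le_max_left _ _) (le_max_right _ _)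
    _ = 2 * (min b c * max b c) := by ring
    _ = 2 * c * b := by rw [min_mul_max]; ring

section

variable {r : ℝ} {ω : ℝ → ℝ≥0∞} {x : ℤ → ℝ}

theorem DyadicMesh.two_zpow_le_lpOn (hx : DyadicMesh r ω x) (hr : 0 < r) {t : ℝ} {k : ℤ} (h : x k < t) :
    (2 : ℝ≥0∞) ^ k ≤ lpOn r ω (Ioo 0 t) := by
  rw [← hx.lpOn_eq k]
  exact monotone_lpOn_Ioo hr ω h.le

theorem DyadicMesh.lpOn_le_two_mul_zpow (hx : DyadicMesh r ω x) (hr : 0 < r) {t : ℝ} {k : ℤ}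
    (h : t ≤ x (k + 1)) : lpOn r ω (Ioo 0 t) ≤ 2 * 2 ^ k := by
  rw [← two_zpow_add_one, ← hx.lpOn_eq (k + 1)]
  exact monotone_lpOn_Ioo hr ω h

theorem DyadicMesh.lpOn_ne_zero (hx : DyadicMesh r ω x) (hr : 0 < r) {t : ℝ} (ht : 0 < t) :
    lpOn r ω (Ioo 0 t) ≠ 0 := by
  obtain ⟨k, hk⟩ := hx.exists_mem t ht
  exact ((two_zpow_pos k).trans_le (hx.two_zpow_le_lpOn hr hk.1)).ne'

theorem DyadicMesh.lpOn_ne_top (hx : DyadicMesh r ω x) (hr : 0 < r) {t : ℝ} (ht : 0 < t) :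
    lpOn r ω (Ioo 0 t) ≠ ∞ := by
  obtain ⟨k, hk⟩ := hx.exists_mem t ht
  exact ne_top_of_le_ne_top (ENNReal.mul_ne_top (by norm_num) (two_zpow_ne_top k))
    (hx.lpOn_le_two_mul_zpow hr hk.2)

/-- The function `min (V t) (2 ^ K) ^ ρ` is, up to constants, the sum of `2 ^ (k ρ)` over the mesh
points `x k < t` with `k ≤ K`; here one of the two inequalities. -/
theorem DyadicMesh.tsum_indicator_le (hx : DyadicMesh r ω x) (hr : 0 < r) {ρ : ℝ} (hρ : 0 < ρ)
    (K : ℤ) {t : ℝ} (ht : 0 < t) :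
    ∑' k : Iic K, (Ioi (x k)).indicator (fun _ => ((2 : ℝ≥0∞) ^ (k : ℤ)) ^ ρ) t ≤
      geomConst ρ * min (lpOn r ω (Ioo 0 t)) (2 ^ K) ^ ρ := by
  obtain ⟨j, hj⟩ := hx.exists_mem t ht
  calc _ ≤ ∑' k : Iic (min j K), ((2 : ℝ≥0∞) ^ (k : ℤ)) ^ ρ := by
        rw [tsum_subtype (Iic K) (fun k => (Ioi (x k)).indicator
            (fun _ => ((2 : ℝ≥0∞) ^ (k : ℤ)) ^ ρ) t),
          tsum_subtype (Iic (min j K)) (fun k => ((2 : ℝ≥0∞) ^ (k : ℤ)) ^ ρ)]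
        refine ENNReal.tsum_le_tsum fun k => ?_
        refine indicator_apply_le' (fun hk => ?_) (fun _ => zero_le)
        refine indicator_apply_le' (fun hkt => ?_) (fun _ => zero_le)
        have : k < j + 1 := hx.strictMono.lt_iff_lt.1 (lt_of_lt_of_le hkt hj.2)
        rw [indicator_of_mem (show k ∈ Iic (min j K) from le_min (Int.lt_add_one_iff.1 this) hk)]
    _ = geomConst ρ * ((2 : ℝ≥0∞) ^ (min j K)) ^ ρ := tsum_Iic_two_zpow_rpow _ ρ
    _ ≤ _ := by
        gcongr
        refine le_min ?_ (ENNReal.zpow_le_of_le (by norm_num) (min_le_right _ _))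
        exact (ENNReal.zpow_le_of_le (by norm_num) (min_le_left _ _)).trans (hx.two_zpow_le_lpOn hr hj.1)

theorem DyadicMesh.exists_index_min (hx : DyadicMesh r ω x) (hr : 0 < r) {s t : ℝ} (hs : 0 < s)
    (ht : 0 < t) : ∃ k, x k < s ∧ x k < t ∧
      min (lpOn r ω (Ioo 0 s)) (lpOn r ω (Ioo 0 t)) ≤ 2 * 2 ^ k := by
  obtain ⟨k, hk⟩ := hx.exists_mem (min s t) (lt_min hs ht)
  refine ⟨k, hk.1.trans_le (min_le_left _ _), hk.1.trans_le (min_le_right _ _), ?_⟩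
  rw [← (monotone_lpOn_Ioo hr ω).map_min]
  exact hx.lpOn_le_two_mul_zpow hr hk.2

/-- The other of the two inequalities between `min (V t) (V s) ^ ρ` and the sum over mesh points. -/
theorem DyadicMesh.min_rpow_le (hx : DyadicMesh r ω x) (hr : 0 < r) {ρ : ℝ} (hρ : 0 < ρ)
    {K : ℤ} {s t : ℝ} (hs : 0 < s) (hsK : s ≤ x (K + 1)) (ht : 0 < t) :
    min (lpOn r ω (Ioo 0 s)) (lpOn r ω (Ioo 0 t)) ^ ρ ≤
      2 ^ ρ * ∑' k : Iic K, (Ioi (x k)).indicator (fun _ => ((2 : ℝ≥0∞) ^ (k : ℤ)) ^ ρ) t := by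
  obtain ⟨k, hks, hkt, hk⟩ := hx.exists_index_min hr hs ht
  have hkK : k ≤ K := by
    have : k < K + 1 := hx.strictMono.lt_iff_lt.1 (hks.trans_le hsK)
    omega
  calc _ ≤ ((2 : ℝ≥0∞) * 2 ^ k) ^ ρ := by gcongr
    _ = 2 ^ ρ * (Ioi (x k)).indicator (fun _ => ((2 : ℝ≥0∞) ^ k) ^ ρ) t := by
        rw [indicator_of_mem (show t ∈ Ioi (x k) from hkt), ENNReal.mul_rpow_of_nonneg _ _ hρ.le]
    _ ≤ _ := by
        gcongr
        exact ENNReal.le_tsum (f := fun k : Iic K =>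
          (Ioi (x k)).indicator (fun _ => ((2 : ℝ≥0∞) ^ (k : ℤ)) ^ ρ) t) ⟨k, hkK⟩

/-- The function `φ₁`, for `V(t) = ‖ω‖_{r,(0,t)}` and real exponents. -/
noncomputable def fundamental (r q : ℝ) (ω u : ℝ → ℝ≥0∞) (y : ℝ) : ℝ≥0∞ :=
  essSup (fun t => lpOn r ω (Ioo 0 t) * kernel (fun t => lpOn r ω (Ioo 0 t)) y t *
    (lpOn q u (Ioo 0 t))⁻¹) (volume.restrict (Ioi 0))

/-- An upper bound for `φ₁` times a constant, which is allowed to be infinite. -/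
theorem fundamental_mul_le {q : ℝ} {u : ℝ → ℝ≥0∞} {y : ℝ} {Z X : ℝ≥0∞}
    (h : ∀ s, 0 < s → lpOn r ω (Ioo 0 s) * kernel (fun t => lpOn r ω (Ioo 0 t)) y s * Z ≤
      X * lpOn q u (Ioo 0 s))
    (hu : ∀ t, 0 < t → 0 < lpOn q u (Ioo 0 t) ∧ lpOn q u (Ioo 0 t) < ∞) :
    fundamental r q ω u y * Z ≤ X := by
  rw [fundamental, mul_comm, ← ENNReal.essSup_const_mul]
  refine essSup_le_of_ae_le X ((ae_restrict_iff' measurableSet_Ioi).2 (Eventually.of_forall ?_))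
  intro s hs
  dsimp only
  calc _ = lpOn r ω (Ioo 0 s) * kernel (fun t => lpOn r ω (Ioo 0 t)) y s * Z *
        (lpOn q u (Ioo 0 s))⁻¹ := by ring
    _ ≤ X * lpOn q u (Ioo 0 s) * (lpOn q u (Ioo 0 s))⁻¹ := by
        gcongr ?_ * _
        exact h s hs
    _ = X := by
        rw [mul_assoc, ENNReal.mul_inv_cancel (hu s hs).1.ne' (hu s hs).2.ne, mul_one]

/-- A lower bound for `φ₁` at the mesh points. The essential supremum is bounded below by the values
on the block to the left of `x K`, where `‖u‖_{q,(0,t)}⁻¹` is at least its value at `x K`. -/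
theorem DyadicMesh.le_fundamental (hx : DyadicMesh r ω x) (hr : 0 < r) {q : ℝ} (hq : 0 < q)
    {u : ℝ → ℝ≥0∞} (hu : ∀ t, 0 < t → 0 < lpOn q u (Ioo 0 t) ∧ lpOn q u (Ioo 0 t) < ∞) (K : ℤ) :
    2 ^ K ≤ 4 * lpOn q u (Ioo 0 (x K)) * fundamental r q ω u (x K) := by
  have hae := ENNReal.ae_le_essSup (μ := volume.restrict (Ioi (0 : ℝ)))
    (fun t => lpOn r ω (Ioo 0 t) * kernel (fun t => lpOn r ω (Ioo 0 t)) (x K) t *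
      (lpOn q u (Ioo 0 t))⁻¹)
  have hlt : x (K - 1) < x K := hx.strictMono (by omega)
  have hsub : Ioo (x (K - 1)) (x K) ⊆ Ioi 0 := fun s hs => (hx.pos (K - 1)).trans hs.1
  have hae' := ae_restrict_of_ae_restrict_of_subset hsub hae
  have : NeBot (ae (volume.restrict (Ioo (x (K - 1)) (x K)))) := by
    rw [ae_neBot, Ne, Measure.restrict_eq_zero]
    simp [hlt]
  obtain ⟨s, hs, hsmem⟩ := (hae'.and (ae_restrict_mem measurableSet_Ioo)).exists
  have hs0 : 0 < s := hsub hsmem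
  set a := lpOn r ω (Ioo 0 s) with ha
  have ha0 : a ≠ 0 := hx.lpOn_ne_zero hr hs0
  have hK : lpOn r ω (Ioo 0 (x K)) = 2 ^ K := hx.lpOn_eq K
  have haK : a ≤ 2 ^ K := by
    rw [← hK]
    exact monotone_lpOn_Ioo hr ω hsmem.2.le
  have h1 : (2 : ℝ≥0∞) ^ K ≤ 2 * a := by
    have := hx.two_zpow_le_lpOn hr hsmem.1
    calc (2 : ℝ≥0∞) ^ K = 2 * 2 ^ (K - 1) := by rw [← two_zpow_add_one, sub_add_cancel]
      _ ≤ 2 * a := by gcongr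
  have h2 : a ≤ 2 * (a * kernel (fun t => lpOn r ω (Ioo 0 t)) (x K) s) := by
    have := min_le_mul_div (two_zpow_pos K).ne' (two_zpow_ne_top K)
      (ne_top_of_le_ne_top (two_zpow_ne_top K) haK)
    rw [min_eq_right haK] at this
    rw [kernel, hK, ← mul_assoc]
    exact this
  have hus := hu s hs0
  have huK := hu (x K) (hx.pos K)
  have h3 : a * kernel (fun t => lpOn r ω (Ioo 0 t)) (x K) s ≤
      lpOn q u (Ioo 0 (x K)) * fundamental r q ω u (x K) := by
    calc _ = lpOn q u (Ioo 0 s) * (a * kernel (fun t => lpOn r ω (Ioo 0 t)) (x K) s *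
          (lpOn q u (Ioo 0 s))⁻¹) := by
          rw [mul_comm (lpOn q u (Ioo 0 s)), mul_assoc, ENNReal.inv_mul_cancel hus.1.ne' hus.2.ne,
            mul_one]
      _ ≤ _ := by
          gcongr
          · exact monotone_lpOn_Ioo hq u hsmem.2.le
          · exact hs
  calc (2 : ℝ≥0∞) ^ K ≤ 2 * (2 * (lpOn q u (Ioo 0 (x K)) * fundamental r q ω u (x K))) := by
        refine h1.trans ?_
        gcongr
        refine h2.trans ?_
        gcongr
    _ = _ := by ring

theorem DyadicMesh.min_le_kernel (hx : DyadicMesh r ω x) (hr : 0 < r) (K : ℤ) {t : ℝ}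
    (ht : 0 < t) : min (lpOn r ω (Ioo 0 t)) (2 ^ K) ≤
      2 * 2 ^ K * kernel (fun t => lpOn r ω (Ioo 0 t)) t (x K) := by
  rw [kernel, hx.lpOn_eq K]
  exact min_le_mul_div (hx.lpOn_ne_zero hr ht) (hx.lpOn_ne_top hr ht) (two_zpow_ne_top K)

/-! #### Supremum form -/

theorem DyadicMesh.iSup_fundamental_le_of_forall_le (hx : DyadicMesh r ω x) (hr : 0 < r)
    {q₁ q₂ : ℝ} (hq₁ : 0 < q₁) (hq₂ : 0 < q₂) {u₁ u₂ : ℝ → ℝ≥0∞}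
    (hu₁ : ∀ t, 0 < t → 0 < lpOn q₁ u₁ (Ioo 0 t) ∧ lpOn q₁ u₁ (Ioo 0 t) < ∞) {D : ℝ≥0∞}
    (hD : ∀ k, 2 ^ k * lpOn q₂ u₂ (Ioi (x k)) ≤ D * lpOn q₁ u₁ (Ioo 0 (x k))) :
    ⨆ y ∈ Ioi (0 : ℝ), fundamental r q₁ ω u₁ y *
      ⨆ t ∈ Ioi (0 : ℝ), kernel (fun t => lpOn r ω (Ioo 0 t)) t y * lpOn q₂ u₂ (Ioi t) ≤
    2 * D := by
  refine iSup₂_le fun y _ => fundamental_mul_le (fun s hs => ?_) hu₁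
  simp only [ENNReal.mul_iSup]
  refine iSup₂_le fun t ht => ?_
  obtain ⟨k, hks, hkt, hk⟩ := hx.exists_index_min hr hs ht
  calc _ = lpOn r ω (Ioo 0 s) * kernel (fun t => lpOn r ω (Ioo 0 t)) y s *
        kernel (fun t => lpOn r ω (Ioo 0 t)) t y * lpOn q₂ u₂ (Ioi t) := by ring
    _ ≤ min (lpOn r ω (Ioo 0 s)) (lpOn r ω (Ioo 0 t)) * lpOn q₂ u₂ (Ioi t) := by
        gcongr
        exact mul_div_mul_div_le_min _ _ _
    _ ≤ 2 * 2 ^ k * lpOn q₂ u₂ (Ioi (x k)) := by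
        gcongr
        exact lpOn_mono hq₂ _ (Ioi_subset_Ioi hkt.le)
    _ = 2 * (2 ^ k * lpOn q₂ u₂ (Ioi (x k))) := by ring
    _ ≤ 2 * (D * lpOn q₁ u₁ (Ioo 0 (x k))) := by
        gcongr 2 * ?_
        exact hD k
    _ ≤ 2 * (D * lpOn q₁ u₁ (Ioo 0 s)) := by
        gcongr
        exact monotone_lpOn_Ioo hq₁ u₁ hks.le
    _ = _ := by ring

theorem DyadicMesh.le_iSup_fundamental (hx : DyadicMesh r ω x) (hr : 0 < r)
    {q₁ q₂ : ℝ} (hq₁ : 0 < q₁) {u₁ u₂ : ℝ → ℝ≥0∞}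
    (hu₁ : ∀ t, 0 < t → 0 < lpOn q₁ u₁ (Ioo 0 t) ∧ lpOn q₁ u₁ (Ioo 0 t) < ∞) (K : ℤ) :
    2 ^ K * lpOn q₂ u₂ (Ioi (x K)) ≤
      8 * (⨆ y ∈ Ioi (0 : ℝ), fundamental r q₁ ω u₁ y *
        ⨆ t ∈ Ioi (0 : ℝ), kernel (fun t => lpOn r ω (Ioo 0 t)) t y * lpOn q₂ u₂ (Ioi t)) *
      lpOn q₁ u₁ (Ioo 0 (x K)) := by
  set Z := ⨆ t ∈ Ioi (0 : ℝ),
    kernel (fun t => lpOn r ω (Ioo 0 t)) t (x K) * lpOn q₂ u₂ (Ioi t) with hZ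
  have h1 : fundamental r q₁ ω u₁ (x K) * Z ≤ ⨆ y ∈ Ioi (0 : ℝ), fundamental r q₁ ω u₁ y *
      ⨆ t ∈ Ioi (0 : ℝ), kernel (fun t => lpOn r ω (Ioo 0 t)) t y * lpOn q₂ u₂ (Ioi t) :=
    le_iSup₂_of_le (x K) (hx.pos K) le_rfl
  have h2 : kernel (fun t => lpOn r ω (Ioo 0 t)) (x K) (x K) * lpOn q₂ u₂ (Ioi (x K)) ≤ Z :=
    le_iSup₂_of_le (f := fun t (_ : t ∈ Ioi (0 : ℝ)) =>
      kernel (fun t => lpOn r ω (Ioo 0 t)) t (x K) * lpOn q₂ u₂ (Ioi t)) (x K) (hx.pos K) le_rfl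
  have h3 := hx.min_le_kernel hr K (hx.pos K)
  rw [hx.lpOn_eq, min_self] at h3
  calc _ ≤ 2 * 2 ^ K * kernel (fun t => lpOn r ω (Ioo 0 t)) (x K) (x K) *
        lpOn q₂ u₂ (Ioi (x K)) := by gcongr
    _ = 2 * 2 ^ K * (kernel (fun t => lpOn r ω (Ioo 0 t)) (x K) (x K) *
        lpOn q₂ u₂ (Ioi (x K))) := by ring
    _ ≤ 2 * (4 * lpOn q₁ u₁ (Ioo 0 (x K)) * fundamental r q₁ ω u₁ (x K)) * Z := by
        gcongr
        exact hx.le_fundamental hr hq₁ hu₁ K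
    _ = 8 * (fundamental r q₁ ω u₁ (x K) * Z) * lpOn q₁ u₁ (Ioo 0 (x K)) := by ring
    _ ≤ _ := by gcongr

/-! #### Integral form -/

theorem DyadicMesh.lintegral_tsum_indicator {μ : Measure ℝ} {ρ : ℝ} (hρ : 0 < ρ) {T : ℝ → ℝ≥0∞}
    (hx : DyadicMesh r ω x) (hμ : ∀ a, 0 < a → μ (Ioi a) = T a ^ ρ) (K : ℤ) :
    ∫⁻ t, ∑' k : Iic K, (Ioi (x k)).indicator (fun _ => ((2 : ℝ≥0∞) ^ (k : ℤ)) ^ ρ) t ∂μ =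
      ∑' k : Iic K, (2 ^ (k : ℤ) * T (x k)) ^ ρ := by
  rw [lintegral_tsum fun k => (measurable_const.indicator measurableSet_Ioi).aemeasurable]
  refine tsum_congr fun k => ?_
  rw [lintegral_indicator measurableSet_Ioi, setLIntegral_const, hμ _ (hx.pos k),
    ENNReal.mul_rpow_of_nonneg _ _ hρ.le]

theorem DyadicMesh.iSup_fundamental_le_of_tsum_le (hx : DyadicMesh r ω x) (hr : 0 < r)
    {q₁ ρ : ℝ} (hq₁ : 0 < q₁) (hρ : 0 < ρ) {u₁ : ℝ → ℝ≥0∞}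
    (hu₁ : ∀ t, 0 < t → 0 < lpOn q₁ u₁ (Ioo 0 t) ∧ lpOn q₁ u₁ (Ioo 0 t) < ∞)
    {μ : Measure ℝ} {T : ℝ → ℝ≥0∞} (hμ : ∀ a, 0 < a → μ (Ioi a) = T a ^ ρ)
    (hμ0 : ∀ᵐ t ∂μ, 0 < t) {D : ℝ≥0∞}
    (hD : ∀ K, (∑' k : Iic K, (2 ^ (k : ℤ) * T (x k)) ^ ρ) ^ (1 / ρ) ≤
      D * lpOn q₁ u₁ (Ioo 0 (x K))) :
    ⨆ y ∈ Ioi (0 : ℝ), fundamental r q₁ ω u₁ y *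
      (∫⁻ t, kernel (fun t => lpOn r ω (Ioo 0 t)) t y ^ ρ ∂μ) ^ (1 / ρ) ≤ 2 * D := by
  refine iSup₂_le fun y hy => fundamental_mul_le (fun s hs => ?_) hu₁
  obtain ⟨K, hK⟩ := hx.exists_mem s hs
  set c := lpOn r ω (Ioo 0 s) * kernel (fun t => lpOn r ω (Ioo 0 t)) y s with hc
  have hcfin : c ≠ ∞ := by
    refine ENNReal.mul_ne_top (hx.lpOn_ne_top hr hs) (ENNReal.div_ne_top (hx.lpOn_ne_top hr hy) ?_)
    exact fun h => hx.lpOn_ne_zero hr hs (add_eq_zero.1 h).2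
  have hint : c ^ ρ * ∫⁻ t, kernel (fun t => lpOn r ω (Ioo 0 t)) t y ^ ρ ∂μ ≤
      2 ^ ρ * ∑' k : Iic K, (2 ^ (k : ℤ) * T (x k)) ^ ρ := by
    rw [← lintegral_const_mul' _ _ (ENNReal.rpow_ne_top_of_nonneg hρ.le hcfin),
      ← hx.lintegral_tsum_indicator hρ hμ, ← lintegral_const_mul' _ _
        (ENNReal.rpow_ne_top_of_nonneg hρ.le (by norm_num))]
    refine lintegral_mono_ae ?_
    filter_upwards [hμ0] with t ht
    rw [← ENNReal.mul_rpow_of_nonneg _ _ hρ.le]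
    refine le_trans ?_ (hx.min_rpow_le hr hρ hs hK.2 ht)
    gcongr
    exact mul_div_mul_div_le_min _ _ _
  clear_value c
  have hroot := ENNReal.rpow_le_rpow hint (z := 1 / ρ) (by positivity)
  rw [ENNReal.mul_rpow_of_nonneg _ _ (by positivity), ENNReal.mul_rpow_of_nonneg _ _ (by positivity),
    ← ENNReal.rpow_mul, ← ENNReal.rpow_mul, mul_one_div_cancel hρ.ne', ENNReal.rpow_one,
    ENNReal.rpow_one] at hroot
  calc _ ≤ 2 * (∑' k : Iic K, (2 ^ (k : ℤ) * T (x k)) ^ ρ) ^ (1 / ρ) := hroot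
    _ ≤ 2 * (D * lpOn q₁ u₁ (Ioo 0 (x K))) := by
        gcongr
        exact hD K
    _ ≤ 2 * (D * lpOn q₁ u₁ (Ioo 0 s)) := by
        gcongr
        exact monotone_lpOn_Ioo hq₁ u₁ hK.1.le
    _ = _ := by ring

theorem DyadicMesh.tsum_le_iSup_fundamental (hx : DyadicMesh r ω x) (hr : 0 < r)
    {q₁ ρ : ℝ} (hq₁ : 0 < q₁) (hρ : 0 < ρ) {u₁ : ℝ → ℝ≥0∞}
    (hu₁ : ∀ t, 0 < t → 0 < lpOn q₁ u₁ (Ioo 0 t) ∧ lpOn q₁ u₁ (Ioo 0 t) < ∞)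
    {μ : Measure ℝ} {T : ℝ → ℝ≥0∞} (hμ : ∀ a, 0 < a → μ (Ioi a) = T a ^ ρ)
    (hμ0 : ∀ᵐ t ∂μ, 0 < t) (K : ℤ) :
    (∑' k : Iic K, (2 ^ (k : ℤ) * T (x k)) ^ ρ) ^ (1 / ρ) ≤
      8 * geomConst ρ ^ (1 / ρ) * (⨆ y ∈ Ioi (0 : ℝ), fundamental r q₁ ω u₁ y *
        (∫⁻ t, kernel (fun t => lpOn r ω (Ioo 0 t)) t y ^ ρ ∂μ) ^ (1 / ρ)) *
      lpOn q₁ u₁ (Ioo 0 (x K)) := by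
  set Z := (∫⁻ t, kernel (fun t => lpOn r ω (Ioo 0 t)) t (x K) ^ ρ ∂μ) ^ (1 / ρ) with hZ
  have h1 : fundamental r q₁ ω u₁ (x K) * Z ≤ ⨆ y ∈ Ioi (0 : ℝ), fundamental r q₁ ω u₁ y *
      (∫⁻ t, kernel (fun t => lpOn r ω (Ioo 0 t)) t y ^ ρ ∂μ) ^ (1 / ρ) :=
    le_iSup₂_of_le (x K) (hx.pos K) le_rfl
  have h2 : ∑' k : Iic K, (2 ^ (k : ℤ) * T (x k)) ^ ρ ≤ geomConst ρ * (2 * 2 ^ K) ^ ρ *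
      ∫⁻ t, kernel (fun t => lpOn r ω (Ioo 0 t)) t (x K) ^ ρ ∂μ := by
    rw [← hx.lintegral_tsum_indicator hρ hμ, ← lintegral_const_mul' _ _ (ENNReal.mul_ne_top
      (geomConst_ne_top hρ) (ENNReal.rpow_ne_top_of_nonneg hρ.le
        (ENNReal.mul_ne_top (by norm_num) (two_zpow_ne_top K))))]
    refine lintegral_mono_ae ?_
    filter_upwards [hμ0] with t ht
    refine (hx.tsum_indicator_le hr hρ K ht).trans ?_
    rw [mul_assoc, ← ENNReal.mul_rpow_of_nonneg _ _ hρ.le]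
    gcongr
    exact hx.min_le_kernel hr K ht
  calc _ ≤ (geomConst ρ * (2 * 2 ^ K) ^ ρ *
        ∫⁻ t, kernel (fun t => lpOn r ω (Ioo 0 t)) t (x K) ^ ρ ∂μ) ^ (1 / ρ) := by gcongr
    _ = geomConst ρ ^ (1 / ρ) * (2 * 2 ^ K) * Z := by
        rw [ENNReal.mul_rpow_of_nonneg _ _ (by positivity),
          ENNReal.mul_rpow_of_nonneg _ _ (by positivity), ← ENNReal.rpow_mul,
          mul_one_div_cancel hρ.ne', ENNReal.rpow_one]
    _ ≤ geomConst ρ ^ (1 / ρ) *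
        (2 * (4 * lpOn q₁ u₁ (Ioo 0 (x K)) * fundamental r q₁ ω u₁ (x K))) * Z := by
        gcongr
        exact hx.le_fundamental hr hq₁ hu₁ K
    _ = 8 * geomConst ρ ^ (1 / ρ) * (fundamental r q₁ ω u₁ (x K) * Z) *
        lpOn q₁ u₁ (Ioo 0 (x K)) := by ring
    _ ≤ _ := by gcongr

end

/-! ### The embedding norm -/

theorem lpOn_congr_ae {p : ℝ} {f g : ℝ → ℝ≥0∞} (h : f =ᵐ[volume.restrict (Ioi 0)] g) {A : Set ℝ}
    (hA : A ⊆ Ioi 0) : lpOn p f A = lpOn p g A := by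
  rw [lpOn, lpOn]
  congr 1
  refine lintegral_congr_ae ?_
  filter_upwards [ae_restrict_of_ae_restrict_of_subset hA h] with s hs
  rw [hs]

theorem cesNorm_congr_ae {p q : ℝ≥0∞} (hp : 0 < p ∧ p < ∞) (hq : 0 < q ∧ q < ∞)
    (u : ℝ → ℝ≥0∞) {v f g : ℝ → ℝ≥0∞}
    (h : (fun x => f x * v x) =ᵐ[volume.restrict (Ioi 0)] g) :
    cesNorm p q u v f =
      lpOn q.toReal (fun t => lpOn p.toReal g (Ioo 0 t) * u t) (Ioi 0) := by
  rw [cesNorm, normOn_eq_lpOn hq]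
  simp only [normOn_eq_lpOn hp, lpOn_congr_ae h Ioo_subset_Ioi_self]

theorem copNorm_congr_ae {p q : ℝ≥0∞} (hp : 0 < p ∧ p < ∞) (hq : 0 < q ∧ q < ∞)
    (u : ℝ → ℝ≥0∞) {v f g : ℝ → ℝ≥0∞}
    (h : (fun x => f x * v x) =ᵐ[volume.restrict (Ioi 0)] g) :
    copNorm p q u v f =
      lpOn q.toReal (fun t => lpOn p.toReal g (Ioi t) * u t) (Ioi 0) := by
  rw [copNorm, normOn_eq_lpOn hq, lpOn, lpOn]
  congr 1
  refine setLIntegral_congr_fun measurableSet_Ioi fun t ht => ?_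
  rw [normOn_eq_lpOn hp, lpOn_congr_ae h (Ioi_subset_Ioi (le_of_lt ht))]

section

variable {p₁ p₂ q₁ q₂ : ℝ≥0∞} {v₁ v₂ u₁ u₂ : ℝ → ℝ≥0∞}

theorem embNorm_le_of_forall (hp₁ : 0 < p₁ ∧ p₁ < ∞) (hp₂ : 0 < p₂ ∧ p₂ < ∞)
    (hq₁ : 0 < q₁ ∧ q₁ < ∞) (hq₂ : 0 < q₂ ∧ q₂ < ∞) (hv₁ : v₁ ∈ Weights) {X : ℝ≥0∞}
    (h : ∀ φ : ℝ → ℝ≥0∞, AEMeasurable φ (volume.restrict (Ioi 0)) →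
      lpOn q₂.toReal (fun t => lpOn p₂.toReal (fun s => φ s * ((v₁ s)⁻¹ * v₂ s)) (Ioo 0 t) * u₂ t)
        (Ioi 0) ≤ X * lpOn q₁.toReal (fun t => lpOn p₁.toReal φ (Ioi t) * u₁ t) (Ioi 0)) :
    embNorm p₁ q₁ u₁ v₁ p₂ q₂ u₂ v₂ ≤ X := by
  refine sInf_le fun f hf => ?_
  rw [copNorm_congr_ae hp₁ hq₁ u₁ (ae_eq_refl _),
    cesNorm_congr_ae (g := fun s => f s * v₁ s * ((v₁ s)⁻¹ * v₂ s)) hp₂ hq₂ u₂ ?_]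
  · exact h _ (hf.1.mul hv₁.1)
  · filter_upwards [hv₁.2] with s hs
    rw [mul_assoc, ← mul_assoc (v₁ s), ENNReal.mul_inv_cancel hs.1.ne' hs.2.ne, one_mul]

theorem le_embNorm_of_forall (hp₁ : 0 < p₁ ∧ p₁ < ∞) (hp₂ : 0 < p₂ ∧ p₂ < ∞)
    (hq₁ : 0 < q₁ ∧ q₁ < ∞) (hq₂ : 0 < q₂ ∧ q₂ < ∞) (hv₁ : v₁ ∈ Weights) {R : ℝ≥0∞} {C : ℝ≥0}
    (hC : 0 < C)
    (h : ∀ c : ℝ≥0∞, (∀ φ : ℝ → ℝ≥0∞, AEMeasurable φ (volume.restrict (Ioi 0)) →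
      lpOn q₁.toReal (fun t => lpOn p₁.toReal φ (Ioi t) * u₁ t) (Ioi 0) < ∞ →
      lpOn q₂.toReal (fun t => lpOn p₂.toReal (fun s => φ s * ((v₁ s)⁻¹ * v₂ s)) (Ioo 0 t) * u₂ t)
        (Ioi 0) ≤ c * lpOn q₁.toReal (fun t => lpOn p₁.toReal φ (Ioi t) * u₁ t) (Ioi 0)) →
      R ≤ C * c) :
    R ≤ C * embNorm p₁ q₁ u₁ v₁ p₂ q₂ u₂ v₂ := by
  have hC0 : (C : ℝ≥0∞) ≠ 0 := by exact_mod_cast hC.ne'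
  rw [mul_comm, ← ENNReal.div_le_iff_le_mul (Or.inl hC0) (Or.inl ENNReal.coe_ne_top)]
  refine le_sInf fun c hc => ?_
  rw [ENNReal.div_le_iff_le_mul (Or.inl hC0) (Or.inl ENNReal.coe_ne_top), mul_comm]
  refine h c fun φ hφ hfin => ?_
  have e1 : (fun s => φ s * (v₁ s)⁻¹ * v₁ s) =ᵐ[volume.restrict (Ioi 0)] φ := by
    filter_upwards [hv₁.2] with s hs
    rw [mul_assoc, ENNReal.inv_mul_cancel hs.1.ne' hs.2.ne, mul_one]
  have e2 : (fun s => φ s * (v₁ s)⁻¹ * v₂ s) =ᵐ[volume.restrict (Ioi 0)]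
      fun s => φ s * ((v₁ s)⁻¹ * v₂ s) := Eventually.of_forall fun s => mul_assoc _ _ _
  have h1 := copNorm_congr_ae hp₁ hq₁ u₁ e1
  have h2 := cesNorm_congr_ae hp₂ hq₂ u₂ e2
  have := hc (fun s => φ s * (v₁ s)⁻¹) ⟨hφ.mul hv₁.1.inv, by rwa [h1]⟩
  rwa [h1, h2] at this

end

end CesaroCopson

theorem theorem7 (p₁ p₂ q₁ q₂ : ℝ≥0∞)
    (hp₁ : 0 < p₁ ∧ p₁ < ∞) (hp₂ : 0 < p₂ ∧ p₂ < ∞)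
    (hq₁ : 0 < q₁ ∧ q₁ < ∞) (hq₂ : 0 < q₂ ∧ q₂ < ∞)
    (hp : p₂ < p₁) (hqp : q₁ ≤ p₂) (hpq : p₂ < q₂) :
    ∃ C : ℝ≥0, 0 < C ∧
      ∀ (v₁ v₂ u₁ u₂ : ℝ → ℝ≥0∞) (_ : v₁ ∈ Weights) (_ : v₂ ∈ Weights)
        (_ : u₁ ∈ DualOmega q₁) (hu₂ : u₂ ∈ Omega q₂)
        (_ : Admissible (V p₁ p₂ v₁ v₂))
        (_ : NondegQuasiconcave (fun x => V p₁ p₂ v₁ v₂ x ^ (1 / (arrow p₁ p₂).toReal))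
          (phi₁ p₁ p₂ q₁ u₁ v₁ v₂)),
        (p₁ ≤ q₂ →
          EquivWith C (embNorm p₁ q₁ u₁ v₁ p₂ q₂ u₂ v₂)
            (⨆ x ∈ Ioi (0 : ℝ), phi₁ p₁ p₂ q₁ u₁ v₁ v₂ x *
              ⨆ t ∈ Ioi (0 : ℝ), kernel (V p₁ p₂ v₁ v₂) t x * normOn q₂ u₂ (Ioi t))) ∧
        (q₂ < p₁ →
          EquivWith C (embNorm p₁ q₁ u₁ v₁ p₂ q₂ u₂ v₂)
            (⨆ x ∈ Ioi (0 : ℝ), phi₁ p₁ p₂ q₁ u₁ v₁ v₂ x *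
              (∫⁻ t, kernel (V p₁ p₂ v₁ v₂) t x ^ (arrow p₁ q₂).toReal
                ∂(tailMeasure hu₂ (arrow p₁ q₂))) ^ (1 / (arrow p₁ q₂).toReal))) := by
  obtain ⟨harr, hr⟩ := arrow_spec (p := p₁) hp₂ hp
  set r := (arrow p₁ p₂).toReal with hrdef
  have pos : ∀ {p : ℝ≥0∞}, 0 < p ∧ p < ∞ → 0 < p.toReal := fun h =>
    ENNReal.toReal_pos h.1.ne' h.2.ne
  have hr0 : 0 < r := pos harr
  have hp' : p₂.toReal < p₁.toReal := (ENNReal.toReal_lt_toReal hp₂.2.ne hp₁.2.ne).2 hp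
  have hqp' : q₁.toReal ≤ p₂.toReal := (ENNReal.toReal_le_toReal hq₁.2.ne hp₂.2.ne).2 hqp
  have hpq' : p₂.toReal < q₂.toReal := (ENNReal.toReal_lt_toReal hp₂.2.ne hq₂.2.ne).2 hpq
  have gfin : ∀ {s a : ℝ}, 0 < s → 0 < a → geomConst s ^ (1 / a) ≠ ∞ := fun hs ha =>
    ENNReal.rpow_ne_top_of_nonneg (by positivity) (geomConst_ne_top hs)
  have hmul : ∀ {a b : ℝ≥0∞}, a ≠ ∞ → b ≠ ∞ → a * b ≠ ∞ := ENNReal.mul_ne_top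
  set L := geomConst r ^ (1 / p₂.toReal) with hL
  set H := 4 * geomConst p₂.toReal ^ (1 / p₂.toReal) * geomConst q₁.toReal ^ (1 / q₁.toReal)
    with hH
  have hLfin : L ≠ ∞ := gfin hr0 (pos hp₂)
  have hHfin : H ≠ ∞ := hmul (hmul (by norm_num) (gfin (pos hp₂) (pos hp₂)))
    (gfin (pos hq₁) (pos hq₁))
  -- `V` and `φ₁` in terms of real exponents, and the mesh of `V`
  have setup : ∀ {v₁ v₂ u₁ : ℝ → ℝ≥0∞}, v₁ ∈ Weights → v₂ ∈ Weights → u₁ ∈ DualOmega q₁ →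
      Admissible (V p₁ p₂ v₁ v₂) →
      V p₁ p₂ v₁ v₂ = (fun t => lpOn r (fun s => (v₁ s)⁻¹ * v₂ s) (Ioo 0 t)) ∧
      phi₁ p₁ p₂ q₁ u₁ v₁ v₂ = fundamental r q₁.toReal (fun s => (v₁ s)⁻¹ * v₂ s) u₁ ∧
      AEMeasurable (fun s => (v₁ s)⁻¹ * v₂ s) (volume.restrict (Ioi 0)) ∧
      (∀ t, 0 < t → 0 < lpOn q₁.toReal u₁ (Ioo 0 t) ∧ lpOn q₁.toReal u₁ (Ioo 0 t) < ∞) ∧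
      ∃ x, DyadicMesh r (fun s => (v₁ s)⁻¹ * v₂ s) x := by
    intro v₁ v₂ u₁ hv₁ hv₂ hu₁ hadm
    have hV : V p₁ p₂ v₁ v₂ = fun t => lpOn r (fun s => (v₁ s)⁻¹ * v₂ s) (Ioo 0 t) :=
      funext fun t => normOn_eq_lpOn harr _ _
    have hω : AEMeasurable (fun s => (v₁ s)⁻¹ * v₂ s) (volume.restrict (Ioi 0)) :=
      hv₁.1.inv.mul hv₂.1
    refine ⟨hV, ?_, hω, fun t ht => ?_, exists_dyadicMesh hr0 hω (hV ▸ hadm)⟩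
    · funext y
      simp only [phi₁, fundamental, hV, normOn_eq_lpOn hq₁]
    · rw [← normOn_eq_lpOn hq₁]
      exact hu₁.2 t ht
  rcases le_or_gt p₁ q₂ with hcase | hcase
  · have hcase' : p₁.toReal ≤ q₂.toReal := (ENNReal.toReal_le_toReal hp₁.2.ne hq₂.2.ne).2 hcase
    have hCfin : 2 * L + H * 8 + 1 ≠ ∞ := by finiteness
    refine ⟨(2 * L + H * 8 + 1).toNNReal, ENNReal.toNNReal_pos (by simp) hCfin, ?_⟩
    intro v₁ v₂ u₁ u₂ hv₁ hv₂ hu₁ hu₂ hadm _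
    obtain ⟨hV, hphi, hω, hu₁', x, hx⟩ := setup hv₁ hv₂ hu₁ hadm
    refine ⟨fun _ => ?_, fun h => absurd h (not_lt.2 hcase)⟩
    simp only [hphi, hV, normOn_eq_lpOn hq₂]
    refine ⟨embNorm_le_of_forall hp₁ hp₂ hq₁ hq₂ hv₁ fun φ hφ => ?_,
      le_embNorm_of_forall hp₁ hp₂ hq₁ hq₂ hv₁ (ENNReal.toNNReal_pos (by simp) hCfin)
        fun c hc => ?_⟩
    · rw [ENNReal.coe_toNNReal hCfin]
      refine (hx.cesaro_le_copson (pos hp₂) hp' hr0 hr (pos hq₁) hqp' hpq' hφ hω hu₁.1 hu₁' hu₂.1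
        (A := 8 * ⨆ y ∈ Ioi (0 : ℝ), fundamental r q₁.toReal (fun s => (v₁ s)⁻¹ * v₂ s) u₁ y *
          ⨆ t ∈ Ioi (0 : ℝ), kernel (fun t => lpOn r (fun s => (v₁ s)⁻¹ * v₂ s) (Ioo 0 t)) t y *
            lpOn q₂.toReal u₂ (Ioi t))
        fun K y => discrete_of_forall_le (pos hp₁) hcase'
          (fun k => 2 ^ k * lpOn q₂.toReal u₂ (Ioi (x k))) K (fun k hk => ?_) y).trans ?_
      · refine (hx.le_iSup_fundamental hr0 (pos hq₁) hu₁' k).trans ?_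
        gcongr
        exact monotone_lpOn_Ioo (pos hq₁) u₁ (hx.strictMono.monotone hk)
      · rw [← mul_assoc, ← mul_assoc]
        gcongr
        exact le_add_right le_add_self
    · rw [ENNReal.coe_toNNReal hCfin]
      refine (hx.iSup_fundamental_le_of_forall_le hr0 (pos hq₁) (pos hq₂) hu₁' (D := L * c)
        fun K => ?_).trans ?_
      · exact le_of_discrete (pos hp₁) (pos hq₂) (fun k => 2 ^ k * lpOn q₂.toReal u₂ (Ioi (x k))) K
          fun y hy hy' => hx.discrete_of_cesaro_le_copson (pos hp₂) (pos hp₁) hr0 hr (pos hq₁) hpq'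
            hω hu₁.1 hu₁' hu₂.1 hc K hy hy'
      · rw [← mul_assoc]
        gcongr
        rw [add_assoc]
        exact le_self_add
  · obtain ⟨harr', hρ⟩ := arrow_spec (p := p₁) hq₂ hcase
    have hcase' : q₂.toReal < p₁.toReal := (ENNReal.toReal_lt_toReal hq₂.2.ne hp₁.2.ne).2 hcase
    set ρ := (arrow p₁ q₂).toReal with hρdef
    have hρ0 : 0 < ρ := pos harr'
    set M := geomConst ρ ^ (1 / ρ) with hM
    have hMfin : M ≠ ∞ := gfin hρ0 hρ0
    have hCfin : 2 * L + H * (8 * M) + 1 ≠ ∞ := by finiteness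
    refine ⟨(2 * L + H * (8 * M) + 1).toNNReal, ENNReal.toNNReal_pos (by simp) hCfin, ?_⟩
    intro v₁ v₂ u₁ u₂ hv₁ hv₂ hu₁ hu₂ hadm _
    obtain ⟨hV, hphi, hω, hu₁', x, hx⟩ := setup hv₁ hv₂ hu₁ hadm
    refine ⟨fun h => absurd hcase (not_lt.2 h), fun _ => ?_⟩
    have hμ : ∀ a, 0 < a → tailMeasure hu₂ (arrow p₁ q₂) (Ioi a) =
        lpOn q₂.toReal u₂ (Ioi a) ^ ρ := fun a ha => tailMeasure_Ioi hq₂ hu₂ hρ0 ha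
    have hμ0 : ∀ᵐ t ∂(tailMeasure hu₂ (arrow p₁ q₂)), 0 < t := stieltjesMeasure_ae_pos _
    simp only [hphi, hV]
    refine ⟨embNorm_le_of_forall hp₁ hp₂ hq₁ hq₂ hv₁ fun φ hφ => ?_,
      le_embNorm_of_forall hp₁ hp₂ hq₁ hq₂ hv₁ (ENNReal.toNNReal_pos (by simp) hCfin)
        fun c hc => ?_⟩
    · rw [ENNReal.coe_toNNReal hCfin]
      refine (hx.cesaro_le_copson (pos hp₂) hp' hr0 hr (pos hq₁) hqp' hpq' hφ hω hu₁.1 hu₁' hu₂.1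
        fun K y => discrete_of_tsum_le (pos hq₂) hcase' hρ
          (fun k => 2 ^ k * lpOn q₂.toReal u₂ (Ioi (x k))) K
          (hx.tsum_le_iSup_fundamental hr0 (pos hq₁) hρ0 hu₁' hμ hμ0 K) y).trans ?_
      rw [← mul_assoc, ← mul_assoc]
      gcongr
      exact le_add_right le_add_self
    · rw [ENNReal.coe_toNNReal hCfin]
      refine (hx.iSup_fundamental_le_of_tsum_le hr0 (pos hq₁) hρ0 hu₁' hμ hμ0 (D := L * c)
        fun K => ?_).trans ?_
      · refine tsum_le_of_discrete (pos hp₁) (pos hq₂) hρ0 hρ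
          (fun k => 2 ^ k * lpOn q₂.toReal u₂ (Ioi (x k))) (fun k => ?_) K
          fun y hy hy' => hx.discrete_of_cesaro_le_copson (pos hp₂) (pos hp₁) hr0 hr (pos hq₁) hpq'
            hω hu₁.1 hu₁' hu₂.1 hc K hy hy'
        rw [← normOn_eq_lpOn hq₂]
        exact hmul (two_zpow_ne_top k) (hu₂.2 _ (hx.pos k)).2.ne
      · rw [← mul_assoc]
        gcongr
        rw [add_assoc]
        exact le_self_add
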